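/- A stochastic multi-armed bandit instance with $n$ arms is a tuple $\nu=(\nu_1,\dots,\nu_n)$ of probability distributions on $[0,1]$ with means $\mu_1,\dots,\mu_n$. An algorithm for retaining $m$ arms adaptively pulls one arm $a_t$ per round (possibly using internal randomness) and receives an independent reward $r_t\sim\nu_{a_t}$. It stops at a stopping time $T$ with respect to the filtration $\mathcal F_t=\sigma(a_1,r_1,\dots,a_t,r_t)$ and then outputs a (possibly randomized) set $S_T$ of exactly $m$ arms. It solves $r$-BAR if on every instance $T<\infty$ almost surely and $$\mathbb E\Bigl[\max_{i\in[n]}\mu_i-\max_{i\in S_T}\mu_i\Bigr]<r.$$ The sample complexity $\mathrm{SC}(n,m,r)$ of $r$-BAR is the infimum, over all algorithms that solve $r$-BAR, of the supremum over all instances of $\mathbb E[T]$. Theorem. The sample complexity of $r$-BAR is $\Theta\left(\frac{(n-m)^3}{(nr)^2}\right)$. Precisely, there is a universal constant $C>0$, and for every $\beta\in(0,1)$ there is a constant $c>0$ depending only on $\beta$, such that for all integers $1\le m<n$ and all real $r>0$, $$\mathrm{SC}(n,m,r)\le C\,\frac{(n-m)^3}{(nr)^2},$$ and, if moreover $r\le(1-\beta)\frac{n-m}{n}$,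 $$\mathrm{SC}(n,m,r)\ge c\,\frac{(n-m)^3}{(nr)^2}.$$ -/

import Mathlib

open MeasureTheory Set
open scoped ENNReal

/-- A stochastic multi-armed bandit instance with `n` arms: arm `i` has the reward distribution
`arm i`, a probability measure on `ℝ` supported in `[0, 1]`. -/
structure BanditInstance (n : ℕ) where
  arm : Fin n → Measure ℝ
  isProbabilityMeasure_arm : ∀ i, IsProbabilityMeasure (arm i)
  bounded_arm : ∀ i, ∀ᵐ x ∂(arm i), x ∈ Icc (0 : ℝ) 1

attribute [instance] BanditInstance.isProbabilityMeasure_arm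

namespace BanditInstance

/-- The mean reward of arm `i`. -/
noncomputable def mean {n : ℕ} (ν : BanditInstance n) (i : Fin n) : ℝ :=
  ∫ x, x ∂(ν.arm i)

/-- The law of the reward table `(X t i)`: in every round `t` a fresh vector of rewards is drawn
from the product distribution `⨂ i, ν_i`, independently of all the other rounds. -/
noncomputable def rewardLaw {n : ℕ} (ν : BanditInstance n) : Measure (ℕ → Fin n → ℝ) :=
  Measure.infinitePi fun _ : ℕ => Measure.pi ν.arm

/-- The gap between the mean of the best arm and the mean of the best arm in `S`. -/
noncomputable def gap {n : ℕ} (ν : BanditInstance n) (S : Finset (Fin n)) : ℝ :=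
  (⨆ i : Fin n, ν.mean i) - ⨆ i : {i // i ∈ S}, ν.mean i

end BanditInstance

/-- The first `t` pairs (arm pulled, reward received) seen by the player. -/
abbrev BanditHistory (n t : ℕ) : Type := Fin t → Fin n × ℝ

/-- A randomized, adaptive algorithm that pulls arms out of `n`, stops, and retains `m` arms.
Its internal randomness is a seed drawn from an arbitrary probability space, independently of the
rewards.  After `t` rounds it stops if the history lies in `haltSet t`; otherwise it pulls the next
arm, as a function of the seed and the history.  When it stops, it retains a set of `m` arms that
depends on the seed and the history. -/
structure RetentionAlgorithm (n m : ℕ) where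
  Seed : Type
  measurableSpaceSeed : MeasurableSpace Seed
  seedLaw : Measure Seed
  isProbabilityMeasure_seedLaw : IsProbabilityMeasure seedLaw
  pull : (t : ℕ) → Seed → BanditHistory n t → Fin n
  measurable_pull : ∀ t : ℕ, Measurable fun p : Seed × BanditHistory n t => pull t p.1 p.2
  haltSet : (t : ℕ) → Set (BanditHistory n t)
  measurableSet_haltSet : ∀ t : ℕ, MeasurableSet (haltSet t)
  output : (t : ℕ) → Seed → BanditHistory n t → Finset (Fin n)
  card_output : ∀ (t : ℕ) (s : Seed) (h : BanditHistory n t), (output t s h).card = m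
  measurableSet_output : ∀ (t : ℕ) (i : Fin n),
    MeasurableSet {p : Seed × BanditHistory n t | i ∈ output t p.1 p.2}

attribute [instance] RetentionAlgorithm.measurableSpaceSeed
attribute [instance] RetentionAlgorithm.isProbabilityMeasure_seedLaw

namespace RetentionAlgorithm

variable {n m : ℕ} (A : RetentionAlgorithm n m)

/-- The sample space: the seed and the reward table. -/
abbrev Sample : Type := A.Seed × (ℕ → Fin n → ℝ)

/-- The law of the sample on the instance `ν`; seed and rewards are independent. -/
noncomputable def law (ν : BanditInstance n) : Measure A.Sample :=
  A.seedLaw.prod ν.rewardLaw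

/-- The history of the first `t` rounds.  In round `t` (counted from `0`) the arm
`a = A.pull t seed history` is pulled and the reward `X t a` is received. -/
def history (ω : A.Sample) : (t : ℕ) → BanditHistory n t
  | 0 => fun i => i.elim0
  | t + 1 =>
    let a : Fin n := A.pull t ω.1 (history ω t)
    Fin.snoc (α := fun _ => Fin n × ℝ) (history ω t) (a, ω.2 t a)

/-- The number `T` of samples: the first `t` at which the stopping rule applies (`⊤` if none). -/
noncomputable def stoppingTime (ω : A.Sample) : ℕ∞ :=
  ⨅ (t : ℕ) (_ : A.history ω t ∈ A.haltSet t), (t : ℕ∞)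

/-- The retained set `S_T`; its value matters only if `T` is finite. -/
noncomputable def retained (ω : A.Sample) : Finset (Fin n) :=
  A.output (A.stoppingTime ω).toNat ω.1 (A.history ω (A.stoppingTime ω).toNat)

/-- The expected number of samples of `A` on the instance `ν`. -/
noncomputable def expectedSamples (ν : BanditInstance n) : ℝ≥0∞ :=
  ∫⁻ ω, (A.stoppingTime ω : ℝ≥0∞) ∂(A.law ν)

/-- `A` solves `r`-BAR: on every instance it stops almost surely and the expected gap between the
best arm and the best retained arm is less than `r`. -/
def SolvesRBAR (r : ℝ) : Prop :=
  ∀ ν : BanditInstance n,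
    (∀ᵐ ω ∂(A.law ν), A.stoppingTime ω ≠ ⊤) ∧ ∫ ω, ν.gap (A.retained ω) ∂(A.law ν) < r

end RetentionAlgorithm

/-- The sample complexity of `r`-BAR: the least expected number of samples, in the worst case over
the instances, of an algorithm that solves `r`-BAR. -/
noncomputable def sampleComplexityRBAR (n m : ℕ) (r : ℝ) : ℝ≥0∞ :=
  ⨅ (A : RetentionAlgorithm n m) (_ : A.SolvesRBAR r),
    ⨆ ν : BanditInstance n, A.expectedSamples ν

/-!
# The sample complexity of retaining `m` of `n` arms

Write `k = n - m` for the number of arms that are discarded.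

**Lower bound.**  Let all arms be `p`-coins, and compare this instance with the `n` instances in
which one arm `j` is a `q`-coin instead, where `d = q - p` is proportional to `n r / k`.  In the
`j`-th of these a good algorithm discards `j` with probability less than `r / d`, which is at most
`(1 - b) k / n`, whereas among identical coins the probabilities of discarding the arms sum to `k`.
So the two laws of the history have to differ.  Their likelihood ratio `D` at the stopping time has
`E[D - 1 - log D]` at most the divergence of one toss times the expected number of pulls of `j`
(`tsum_lintegral_logDeficit_le`; working with the nonnegative function `x - 1 - log x` avoids all
integrability questions, even for unbounded stopping times).  Bounding `log` by its tangent at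
`1 - b` gives an inequality that is linear in the two probabilities (`measure_notMem_retained_le`).
A sum over `j` then costs nothing, and yields `E[T] ≥ c k / d²`, that is `c k³ / (n r)²`; the
quadratic loss of Pinsker's inequality would give only `k⁴ / n` in place of `k³`.

**Upper bound.**  If `r > k / n`, retaining everything outside a random window of `k` arms is good
enough (`blindGuess`).  Otherwise pick a random cyclic window of `k + 1` arms, find an almost
optimal arm in it, and discard the other `k` (`tournament`).  The best arm lies in the window with
probability `(k + 1) / n` only, so a loss of order `n r / k` within the window is affordable.  The
search is a knockout tournament of duels.  Only the roughly `log₂ k` duels on the path of the best arm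
contribute to the expected loss, each at most twice the mean error of an empirical mean
(`lintegral_mean_slotArm_le`).  Since the number of arms halves from level to level, the number of
pulls of each arm can grow by a factor of about `25 / 16` per level: then both the total number of
samples and the total loss are geometric sums, so that no logarithm is lost.
-/

/-! ### Resampling the future of an i.i.d. sequence -/

/-- The sequence that agrees with `x` before time `t` and with `y` from time `t` on. -/
def spliceAt {E : Type*} (t : ℕ) (x y : ℕ → E) : ℕ → E := fun u => if u < t then x u else y u

theorem spliceAt_of_lt {E : Type*} {t u : ℕ} (h : u < t) (x y : ℕ → E) :
    spliceAt t x y u = x u := if_pos h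

theorem spliceAt_of_le {E : Type*} {t u : ℕ} (h : t ≤ u) (x y : ℕ → E) :
    spliceAt t x y u = y u := if_neg h.not_gt

theorem measurable_spliceAt {E : Type*} [MeasurableSpace E] (t : ℕ) :
    Measurable fun p : (ℕ → E) × (ℕ → E) => spliceAt t p.1 p.2 := by
  refine measurable_pi_lambda _ fun u => ?_
  by_cases h : u < t
  · simp only [spliceAt, h, if_true]; fun_prop
  · simp only [spliceAt, h, if_false]; fun_prop

/-- Replacing the future of an i.i.d. sequence by that of an independent copy keeps its law. -/
theorem measurePreserving_spliceAt {E : Type*} [MeasurableSpace E] (ρ : Measure E)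
    [IsProbabilityMeasure ρ] (t : ℕ) :
    MeasurePreserving (fun p : (ℕ → E) × (ℕ → E) => spliceAt t p.1 p.2)
      ((Measure.infinitePi fun _ : ℕ => ρ).prod (Measure.infinitePi fun _ : ℕ => ρ))
      (Measure.infinitePi fun _ : ℕ => ρ) := by
  refine ⟨measurable_spliceAt t, Measure.eq_infinitePi _ fun s B hB => ?_⟩
  have hpre : (fun p : (ℕ → E) × (ℕ → E) => spliceAt t p.1 p.2) ⁻¹' (Set.pi s B)
      = (Set.pi (s.filter (· < t) : Finset ℕ) B) ×ˢ
        (Set.pi (s.filter (fun u => ¬ u < t) : Finset ℕ) B) := by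
    ext p
    simp only [mem_preimage, mem_pi, Finset.mem_coe, mem_prod, Finset.mem_filter, spliceAt]
    constructor
    · intro h
      refine ⟨fun u hu => ?_, fun u hu => ?_⟩
      · simpa [hu.2] using h u hu.1
      · simpa only [hu.2, if_false] using h u hu.1
    · rintro ⟨h1, h2⟩ u hu
      by_cases hut : u < t
      · simpa [hut] using h1 u ⟨hu, hut⟩
      · simpa only [hut, if_false] using h2 u ⟨hu, hut⟩
  rw [Measure.map_apply (measurable_spliceAt t)
    (MeasurableSet.pi s.countable_toSet fun u _ => hB u), hpre, Measure.prod_prod,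
    Measure.infinitePi_pi _ fun u _ => hB u, Measure.infinitePi_pi _ fun u _ => hB u,
    Finset.prod_filter_mul_prod_filter_not]

namespace BanditInstance

variable {n : ℕ} (ν : BanditInstance n)

instance : IsProbabilityMeasure ν.rewardLaw := by
  unfold rewardLaw; infer_instance

/-- Rewards may be averaged by drawing the past and the future from independent tables. -/
theorem lintegral_rewardLaw_splice (t : ℕ) {G : (ℕ → Fin n → ℝ) → ℝ≥0∞} (hG : Measurable G) :
    ∫⁻ x, G x ∂ν.rewardLaw
      = ∫⁻ x, ∫⁻ y, G (spliceAt t x y) ∂ν.rewardLaw ∂ν.rewardLaw := by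
  have h := measurePreserving_spliceAt (Measure.pi ν.arm) t
  rw [← lintegral_prod (fun p : (ℕ → Fin n → ℝ) × (ℕ → Fin n → ℝ) => G (spliceAt t p.1 p.2))
    (hG.comp (measurable_spliceAt t)).aemeasurable]
  exact (h.lintegral_comp hG).symm

theorem measurePreserving_eval (t : ℕ) (i : Fin n) :
    MeasurePreserving (fun x : ℕ → Fin n → ℝ => x t i) ν.rewardLaw (ν.arm i) :=
  (MeasureTheory.measurePreserving_eval ν.arm i).comp
    (measurePreserving_eval_infinitePi (fun _ : ℕ => Measure.pi ν.arm) t)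

end BanditInstance

/-! ### The history of a run -/

theorem measurable_fin_snoc {n t : ℕ} :
    Measurable fun p : BanditHistory n t × (Fin n × ℝ) =>
      (Fin.snoc (α := fun _ => Fin n × ℝ) p.1 p.2 : BanditHistory n (t + 1)) := by
  refine measurable_pi_lambda _ fun u => ?_
  refine Fin.lastCases ?_ (fun v => ?_) u
  · simpa using measurable_snd
  · simp only [Fin.snoc_castSucc]; fun_prop

namespace RetentionAlgorithm

variable {n m : ℕ} (A : RetentionAlgorithm n m)

instance (ν : BanditInstance n) : IsProbabilityMeasure (A.law ν) := by
  unfold law; infer_instance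

theorem history_succ (ω : A.Sample) (t : ℕ) :
    A.history ω (t + 1) = Fin.snoc (α := fun _ => Fin n × ℝ) (A.history ω t)
      (A.pull t ω.1 (A.history ω t), ω.2 t (A.pull t ω.1 (A.history ω t))) := rfl

theorem history_congr (s : A.Seed) {x y : ℕ → Fin n → ℝ} {t : ℕ} (h : ∀ u < t, x u = y u) :
    A.history (s, x) t = A.history (s, y) t := by
  induction t with
  | zero => rfl
  | succ t ih =>
    rw [history_succ, history_succ, ih fun u hu => h u (hu.trans t.lt_succ_self)]
    simp only [h t t.lt_succ_self]

theorem measurable_history (t : ℕ) : Measurable fun ω : A.Sample => A.history ω t := by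
  induction t with
  | zero => exact measurable_pi_lambda _ fun i => i.elim0
  | succ t ih =>
    have ha : Measurable fun ω : A.Sample => A.pull t ω.1 (A.history ω t) :=
      (A.measurable_pull t).comp (measurable_fst.prodMk ih)
    have hx : Measurable fun ω : A.Sample => ω.2 t (A.pull t ω.1 (A.history ω t)) := by
      have : Measurable fun p : Fin n × A.Sample => p.2.2 t p.1 :=
        measurable_from_prod_countable_right fun i =>
          (measurable_pi_apply i).comp ((measurable_pi_apply t).comp measurable_snd)
      exact this.comp (ha.prodMk measurable_id)
    exact measurable_fin_snoc.comp (ih.prodMk (ha.prodMk hx))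

theorem measurable_seed_history (t : ℕ) :
    Measurable fun ω : A.Sample => (ω.1, A.history ω t) :=
  measurable_fst.prodMk (A.measurable_history t)

theorem measurable_pull_history (t : ℕ) :
    Measurable fun ω : A.Sample => A.pull t ω.1 (A.history ω t) :=
  (A.measurable_pull t).comp (A.measurable_seed_history t)

/-- Given the first `t` rounds, the next reward is a fresh draw from the arm that is pulled. -/
theorem lintegral_history_succ (ν : BanditInstance n) (t : ℕ)
    {F : A.Seed × BanditHistory n (t + 1) → ℝ≥0∞} (hF : Measurable F) :
    ∫⁻ ω, F (ω.1, A.history ω (t + 1)) ∂(A.law ν)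
      = ∫⁻ ω, ∫⁻ x, F (ω.1, Fin.snoc (α := fun _ => Fin n × ℝ) (A.history ω t)
          (A.pull t ω.1 (A.history ω t), x)) ∂(ν.arm (A.pull t ω.1 (A.history ω t)))
          ∂(A.law ν) := by
  have hL : Measurable fun ω : A.Sample => F (ω.1, A.history ω (t + 1)) :=
    hF.comp (A.measurable_seed_history _)
  have hR : Measurable fun ω : A.Sample =>
      ∫⁻ x, F (ω.1, Fin.snoc (α := fun _ => Fin n × ℝ) (A.history ω t)
          (A.pull t ω.1 (A.history ω t), x)) ∂(ν.arm (A.pull t ω.1 (A.history ω t))) := by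
    have : Measurable fun p : Fin n × A.Sample =>
        ∫⁻ x, F (p.2.1, Fin.snoc (α := fun _ => Fin n × ℝ) (A.history p.2 t)
          (p.1, x)) ∂(ν.arm p.1) := by
      refine measurable_from_prod_countable_right fun i => ?_
      refine Measurable.lintegral_prod_right' (ν := ν.arm i) (f := fun p : A.Sample × ℝ =>
        F (p.1.1, Fin.snoc (α := fun _ => Fin n × ℝ) (A.history p.1 t) (i, p.2))) ?_
      refine hF.comp (measurable_fst.fst.prodMk (measurable_fin_snoc.comp
        (((A.measurable_history t).comp measurable_fst).prodMk
          (measurable_const.prodMk measurable_snd))))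
    exact this.comp ((A.measurable_pull_history t).prodMk measurable_id)
  unfold law
  rw [lintegral_prod _ hL.aemeasurable, lintegral_prod _ hR.aemeasurable]
  refine lintegral_congr fun s => ?_
  have hs : Measurable fun x => F (s, A.history (s, x) (t + 1)) :=
    hL.comp (measurable_prodMk_left (x := s))
  refine (ν.lintegral_rewardLaw_splice t hs).trans ?_
  refine lintegral_congr fun x => ?_
  have hy : ∀ y, A.history (s, spliceAt t x y) (t + 1)
      = Fin.snoc (α := fun _ => Fin n × ℝ) (A.history (s, x) t)
        (A.pull t s (A.history (s, x) t), y t (A.pull t s (A.history (s, x) t))) := by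
    intro y
    rw [history_succ, A.history_congr s fun u hu => spliceAt_of_lt hu x y]
    simp only [spliceAt_of_le le_rfl]
  simp only [hy]
  refine (ν.measurePreserving_eval t (A.pull t s (A.history (s, x) t))).lintegral_comp
    (f := fun z => F (s, Fin.snoc (α := fun _ => Fin n × ℝ) (A.history (s, x) t)
        (A.pull t s (A.history (s, x) t), z))) ?_
  exact hF.comp (measurable_const.prodMk (measurable_fin_snoc.comp
    (measurable_const.prodMk (measurable_const.prodMk measurable_id))))

end RetentionAlgorithm

/-! ### The stopping time and the retained set -/

namespace RetentionAlgorithm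

variable {n m : ℕ} (A : RetentionAlgorithm n m)

theorem coe_le_stoppingTime_iff (ω : A.Sample) (t : ℕ) :
    (t : ℕ∞) ≤ A.stoppingTime ω ↔ ∀ u < t, A.history ω u ∉ A.haltSet u := by
  simp only [stoppingTime, le_iInf_iff, Nat.cast_le]
  exact ⟨fun h u hu hmem => (h u hmem).not_gt hu, fun h u hmem => not_lt.1 fun hu => h u hu hmem⟩

theorem coe_lt_stoppingTime_iff (ω : A.Sample) (t : ℕ) :
    (t : ℕ∞) < A.stoppingTime ω ↔
      (t : ℕ∞) ≤ A.stoppingTime ω ∧ A.history ω t ∉ A.haltSet t := by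
  have h : (t : ℕ∞) < A.stoppingTime ω ↔ ((t + 1 : ℕ) : ℕ∞) ≤ A.stoppingTime ω := by
    rw [Nat.cast_add, Nat.cast_one, ENat.add_one_le_iff (ENat.natCast_ne_top t)]
  rw [h, coe_le_stoppingTime_iff, coe_le_stoppingTime_iff]
  simp only [Nat.lt_succ_iff_lt_or_eq, or_imp, forall_and, forall_eq]

theorem stoppingTime_eq_coe_iff (ω : A.Sample) (t : ℕ) :
    A.stoppingTime ω = t ↔ (t : ℕ∞) ≤ A.stoppingTime ω ∧ A.history ω t ∈ A.haltSet t := by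
  have h := A.coe_lt_stoppingTime_iff ω t
  constructor
  · intro hT
    refine ⟨hT.ge, by_contra fun hn => ?_⟩
    exact (h.2 ⟨hT.ge, hn⟩).ne' hT
  · rintro ⟨h1, h2⟩
    exact le_antisymm (not_lt.1 fun hlt => (h.1 hlt).2 h2) h1

theorem measurableSet_coe_le_stoppingTime (t : ℕ) :
    MeasurableSet {ω : A.Sample | (t : ℕ∞) ≤ A.stoppingTime ω} := by
  simp only [coe_le_stoppingTime_iff, ofPred_forall]
  exact MeasurableSet.iInter fun u => MeasurableSet.iInter fun _ =>
    ((A.measurable_history u) (A.measurableSet_haltSet u)).compl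

theorem measurableSet_coe_lt_stoppingTime (t : ℕ) :
    MeasurableSet {ω : A.Sample | (t : ℕ∞) < A.stoppingTime ω} := by
  simp only [coe_lt_stoppingTime_iff]
  exact (A.measurableSet_coe_le_stoppingTime t).inter
    ((A.measurable_history t) (A.measurableSet_haltSet t)).compl

theorem measurableSet_stoppingTime_eq_coe (t : ℕ) :
    MeasurableSet {ω : A.Sample | A.stoppingTime ω = t} := by
  simp only [stoppingTime_eq_coe_iff]
  exact (A.measurableSet_coe_le_stoppingTime t).inter
    ((A.measurable_history t) (A.measurableSet_haltSet t))

theorem measurableSet_toNat_stoppingTime_eq (t : ℕ) :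
    MeasurableSet {ω : A.Sample | (A.stoppingTime ω).toNat = t} := by
  have htop : MeasurableSet {ω : A.Sample | A.stoppingTime ω = ⊤} := by
    have : {ω : A.Sample | A.stoppingTime ω = ⊤} =
        (⋃ t : ℕ, {ω : A.Sample | A.stoppingTime ω = t})ᶜ := by
      ext ω
      simp only [mem_ofPred_eq, mem_compl_iff, mem_iUnion]
      refine not_iff_not.1 ?_
      rw [not_not, ← Ne, ENat.ne_top_iff_exists]
      exact exists_congr fun t => eq_comm
    rw [this]
    exact (MeasurableSet.iUnion fun t => A.measurableSet_stoppingTime_eq_coe t).compl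
  rcases Nat.eq_zero_or_pos t with rfl | ht
  · have : {ω : A.Sample | (A.stoppingTime ω).toNat = 0} =
        {ω : A.Sample | A.stoppingTime ω = (0 : ℕ)} ∪ {ω : A.Sample | A.stoppingTime ω = ⊤} := by
      ext ω
      simp
    rw [this]
    exact (A.measurableSet_stoppingTime_eq_coe 0).union htop
  · have : {ω : A.Sample | (A.stoppingTime ω).toNat = t} =
        {ω : A.Sample | A.stoppingTime ω = t} := by
      ext ω
      simp only [mem_ofPred_eq]
      exact ENat.toNat_eq_iff ht.ne'
    rw [this]
    exact A.measurableSet_stoppingTime_eq_coe t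

theorem measurableSet_mem_retained (i : Fin n) :
    MeasurableSet {ω : A.Sample | i ∈ A.retained ω} := by
  have : {ω : A.Sample | i ∈ A.retained ω} =
      ⋃ t : ℕ, {ω : A.Sample | (A.stoppingTime ω).toNat = t} ∩
        {ω : A.Sample | i ∈ A.output t ω.1 (A.history ω t)} := by
    ext ω
    simp only [mem_ofPred_eq, mem_iUnion, mem_inter_iff]
    constructor
    · exact fun h => ⟨_, rfl, h⟩
    · rintro ⟨t, rfl, h⟩
      exact h
  rw [this]
  exact MeasurableSet.iUnion fun t => (A.measurableSet_toNat_stoppingTime_eq t).inter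
    ((A.measurable_seed_history t) (A.measurableSet_output t i))

theorem card_retained (ω : A.Sample) : (A.retained ω).card = m := A.card_output _ _ _

/-- `E[T] = ∑ P(t < T)`. -/
theorem expectedSamples_eq_tsum (ν : BanditInstance n) :
    A.expectedSamples ν = ∑' t : ℕ, A.law ν {ω | (t : ℕ∞) < A.stoppingTime ω} := by
  have key : ∀ N : ℕ∞, (N : ℝ≥0∞) = ∑' t : ℕ, {t : ℕ | (t : ℕ∞) < N}.indicator 1 t := by
    intro N
    rw [← tsum_subtype {t : ℕ | (t : ℕ∞) < N} (1 : ℕ → ℝ≥0∞)]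
    simp only [Pi.one_apply]
    rw [ENNReal.tsum_set_one]
    induction N using ENat.recTopCoe with
    | top => simp
    | coe N =>
      have : {t : ℕ | (t : ℕ∞) < (N : ℕ∞)} = (Finset.range N : Set ℕ) := by ext; simp
      rw [this, encard_coe_eq_coe_finsetCard, Finset.card_range]
  have h : ∀ ω, (A.stoppingTime ω : ℝ≥0∞) =
      ∑' t : ℕ, {ω | (t : ℕ∞) < A.stoppingTime ω}.indicator 1 ω := fun ω => by
    rw [key]; rfl
  simp only [expectedSamples, h]
  rw [lintegral_tsum fun t =>
    (measurable_one.indicator (A.measurableSet_coe_lt_stoppingTime t)).aemeasurable]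
  exact tsum_congr fun t => lintegral_indicator_one (A.measurableSet_coe_lt_stoppingTime t)

/-- The histories of length `t` at none of whose proper prefixes the algorithm stops. -/
def running : (t : ℕ) → Set (BanditHistory n t)
  | 0 => univ
  | t + 1 => {h | Fin.init h ∈ running t ∧ (Fin.init h : BanditHistory n t) ∉ A.haltSet t}

theorem snoc_mem_running {t : ℕ} {h : BanditHistory n t} {a : Fin n × ℝ} :
    (Fin.snoc (α := fun _ => Fin n × ℝ) h a : BanditHistory n (t + 1)) ∈ A.running (t + 1) ↔
      h ∈ A.running t ∧ h ∉ A.haltSet t := by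
  simp only [running, mem_ofPred_eq, Fin.init_snoc]

theorem measurableSet_running (t : ℕ) : MeasurableSet (A.running t) := by
  induction t with
  | zero => exact MeasurableSet.univ
  | succ t ih =>
    have : Measurable fun h : BanditHistory n (t + 1) => (Fin.init h : BanditHistory n t) :=
      measurable_pi_lambda _ fun u => measurable_pi_apply u.castSucc
    exact (this ih).inter (this (A.measurableSet_haltSet t)).compl

theorem history_mem_running_iff (ω : A.Sample) (t : ℕ) :
    A.history ω t ∈ A.running t ↔ (t : ℕ∞) ≤ A.stoppingTime ω := by
  induction t with
  | zero => simp [running]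
  | succ t ih =>
    rw [history_succ, snoc_mem_running, ih, ← coe_lt_stoppingTime_iff, Nat.cast_add, Nat.cast_one,
      ENat.add_one_le_iff (ENat.natCast_ne_top t)]

end RetentionAlgorithm

/-! ### Coin-tossing instances and change of measure -/

namespace BanditInstance

variable {n : ℕ}

/-- The instance whose arm `i` pays `1` with probability `p i` and `0` otherwise. -/
noncomputable def coin (p : Fin n → unitInterval) : BanditInstance n where
  arm i := ProbabilityTheory.bernoulliMeasure 1 0 (p i)
  isProbabilityMeasure_arm _ := inferInstance
  bounded_arm i := by
    rw [ae_iff, ProbabilityTheory.bernoulliMeasure_apply_of_notMem_of_notMem]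
    · exact measurableSet_Icc.compl
    · simp
    · simp

theorem mean_coin (p : Fin n → unitInterval) (i : Fin n) : (coin p).mean i = p i := by
  simp [mean, coin, ProbabilityTheory.integral_bernoulliMeasure]

theorem lintegral_arm_coin (p : Fin n → unitInterval) (i : Fin n) (f : ℝ → ℝ≥0∞) :
    ∫⁻ x, f x ∂((coin p).arm i)
      = ENNReal.ofReal (p i) * f 1 + ENNReal.ofReal (1 - p i) * f 0 := by
  have h1 : ((unitInterval.toNNReal (p i) : NNReal) : ℝ≥0∞) = ENNReal.ofReal (p i) := by
    rw [ENNReal.ofReal_eq_coe_nnreal (p i).2.1]; rfl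
  have h2 : ((unitInterval.toNNReal (unitInterval.symm (p i)) : NNReal) : ℝ≥0∞)
      = ENNReal.ofReal (1 - p i) := by
    rw [ENNReal.ofReal_eq_coe_nnreal (by linarith [(p i).2.2])]; rfl
  simp only [coin, ProbabilityTheory.bernoulliMeasure_def]
  rw [lintegral_add_measure, lintegral_smul_measure, lintegral_smul_measure, lintegral_dirac,
    lintegral_dirac, ENNReal.smul_def, ENNReal.smul_def, smul_eq_mul, smul_eq_mul, h1, h2]

end BanditInstance

/-- The likelihood ratio of a single toss `x ∈ {0, 1}`: a `q`-coin against a `p`-coin. -/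
noncomputable def coinRatio (p q x : ℝ) : ℝ := if x = 1 then q / p else (1 - q) / (1 - p)

theorem measurable_coinRatio (p q : ℝ) : Measurable (coinRatio p q) :=
  Measurable.ite (measurableSet_singleton 1) measurable_const measurable_const

theorem coinRatio_pos {p q : ℝ} (hp : p ∈ Ioo (0 : ℝ) 1) (hq : q ∈ Ioo (0 : ℝ) 1) (x : ℝ) :
    0 < coinRatio p q x := by
  unfold coinRatio
  split_ifs
  · exact div_pos hq.1 hp.1
  · exact div_pos (sub_pos.2 hq.2) (sub_pos.2 hp.2)

/-- The Kullback–Leibler divergence of a `p`-coin from a `q`-coin. -/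
noncomputable def coinKL (p q : ℝ) : ℝ :=
  -(p * Real.log (coinRatio p q 1) + (1 - p) * Real.log (coinRatio p q 0))

/-- The likelihood ratio of a history when arm `j` is a `q`-coin instead of a `p`-coin and all the
other arms are unchanged. -/
noncomputable def likelihoodRatio {n : ℕ} (p q : ℝ) (j : Fin n) {t : ℕ}
    (h : BanditHistory n t) : ℝ :=
  ∏ u, if (h u).1 = j then coinRatio p q (h u).2 else 1

section LikelihoodRatio

variable {n : ℕ} {p q : ℝ} {j : Fin n} {t : ℕ}

theorem likelihoodRatio_snoc (h : BanditHistory n t) (a : Fin n) (x : ℝ) :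
    likelihoodRatio p q j (Fin.snoc (α := fun _ => Fin n × ℝ) h (a, x) : BanditHistory n (t + 1))
      = likelihoodRatio p q j h * if a = j then coinRatio p q x else 1 := by
  simp only [likelihoodRatio, Fin.prod_univ_castSucc, Fin.snoc_castSucc, Fin.snoc_last]

theorem likelihoodRatio_pos (hp : p ∈ Ioo (0 : ℝ) 1) (hq : q ∈ Ioo (0 : ℝ) 1)
    (h : BanditHistory n t) : 0 < likelihoodRatio p q j h :=
  Finset.prod_pos fun u _ => by
    split_ifs
    · exact coinRatio_pos hp hq _
    · exact one_pos

theorem measurable_likelihoodRatio :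
    Measurable fun h : BanditHistory n t => likelihoodRatio p q j h := by
  refine Finset.measurable_prod _ fun u _ => Measurable.ite ?_ ?_ measurable_const
  · exact (measurable_pi_apply u).fst (measurableSet_singleton j)
  · exact (measurable_coinRatio p q).comp (measurable_pi_apply u).snd

end LikelihoodRatio

/-- The Bregman divergence of `x ↦ - log x` at `x` and `1`; a nonnegative substitute for `- log`
along a likelihood ratio, whose mean is `1`. -/
noncomputable def logDeficit (x : ℝ) : ℝ := x - 1 - Real.log x

theorem logDeficit_nonneg {x : ℝ} (hx : 0 < x) : 0 ≤ logDeficit x := by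
  have := Real.log_le_sub_one_of_pos hx
  unfold logDeficit; linarith

theorem measurable_logDeficit : Measurable logDeficit := by
  unfold logDeficit; fun_prop

/-- The linear lower bound for `logDeficit` by the tangent of `log` at `l`. -/
theorem neg_log_le_logDeficit_add {l x : ℝ} (hl : 0 < l) (hx : 0 < x) :
    -Real.log l ≤ logDeficit x + (1 / l - 1) * x := by
  have h := Real.log_le_sub_one_of_pos (div_pos hx hl)
  rw [Real.log_div hx.ne' hl.ne'] at h
  have : x / l = 1 / l * x := by ring
  unfold logDeficit; linarith

/-- One toss of the coin increases the expected `logDeficit` by exactly the divergence. -/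
theorem logDeficit_mul_coinRatio {p q x : ℝ} (hp : p ∈ Ioo (0 : ℝ) 1) (hq : q ∈ Ioo (0 : ℝ) 1)
    (hx : 0 < x) :
    p * logDeficit (x * coinRatio p q 1) + (1 - p) * logDeficit (x * coinRatio p q 0)
      = logDeficit x + coinKL p q := by
  have h1 := (coinRatio_pos hp hq 1).ne'
  have h0 := (coinRatio_pos hp hq 0).ne'
  have hm : p * coinRatio p q 1 + (1 - p) * coinRatio p q 0 = 1 := by
    have := hp.1.ne'
    have := (sub_pos.2 hp.2).ne'
    simp only [coinRatio, if_true, zero_ne_one, if_false]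
    field_simp
    ring
  simp only [logDeficit, coinKL, Real.log_mul hx.ne' h1, Real.log_mul hx.ne' h0]
  linear_combination x * hm

theorem coinKL_nonneg {p q : ℝ} (hp : p ∈ Ioo (0 : ℝ) 1) (hq : q ∈ Ioo (0 : ℝ) 1) :
    0 ≤ coinKL p q := by
  have h := logDeficit_mul_coinRatio hp hq one_pos
  have h1 := logDeficit_nonneg (coinRatio_pos hp hq 1)
  have h0 := logDeficit_nonneg (coinRatio_pos hp hq 0)
  have h' : logDeficit 1 = 0 := by simp [logDeficit]
  rw [one_mul, one_mul, h', zero_add] at h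
  rw [← h]
  exact add_nonneg (mul_nonneg hp.1.le h1) (mul_nonneg (sub_nonneg.2 hp.2.le) h0)

/-- The Kullback–Leibler divergence is at most the `χ²` divergence. -/
theorem coinKL_le {p q : ℝ} (hp : p ∈ Ioo (0 : ℝ) 1) (hq : q ∈ Ioo (0 : ℝ) 1) :
    coinKL p q ≤ (q - p) ^ 2 / (q * (1 - q)) := by
  have hp' := sub_pos.2 hp.2
  have hq' := sub_pos.2 hq.2
  have h1 := Real.one_sub_inv_le_log_of_pos (coinRatio_pos hp hq 1)
  have h0 := Real.one_sub_inv_le_log_of_pos (coinRatio_pos hp hq 0)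
  have e : -(p * (1 - (coinRatio p q 1)⁻¹) + (1 - p) * (1 - (coinRatio p q 0)⁻¹))
      = (q - p) ^ 2 / (q * (1 - q)) := by
    have := hp.1.ne'
    have := hq.1.ne'
    simp only [coinRatio, if_true, zero_ne_one, if_false]
    field_simp
    ring
  rw [← e, coinKL]
  have := mul_le_mul_of_nonneg_left h1 hp.1.le
  have := mul_le_mul_of_nonneg_left h0 hp'.le
  linarith

namespace RetentionAlgorithm

open BanditInstance

variable {n m : ℕ} (A : RetentionAlgorithm n m)

/-- The seed and history after one more round in which the arm that is pulled pays `x`. -/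
def extend {t : ℕ} (x : ℝ) (z : A.Seed × BanditHistory n t) :
    A.Seed × BanditHistory n (t + 1) :=
  (z.1, Fin.snoc (α := fun _ => Fin n × ℝ) z.2 (A.pull t z.1 z.2, x))

theorem measurable_extend {t : ℕ} (x : ℝ) :
    Measurable (A.extend x : A.Seed × BanditHistory n t → _) :=
  measurable_fst.prodMk (measurable_fin_snoc.comp
    (measurable_snd.prodMk ((A.measurable_pull t).prodMk measurable_const)))

theorem lintegral_coin_history_succ (p : Fin n → unitInterval) (t : ℕ)
    {F : A.Seed × BanditHistory n (t + 1) → ℝ≥0∞} (hF : Measurable F) :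
    ∫⁻ ω, F (ω.1, A.history ω (t + 1)) ∂(A.law (coin p))
      = ∫⁻ ω, (fun z : A.Seed × BanditHistory n t =>
          ENNReal.ofReal (p (A.pull t z.1 z.2)) * F (A.extend 1 z)
            + ENNReal.ofReal (1 - p (A.pull t z.1 z.2)) * F (A.extend 0 z))
          (ω.1, A.history ω t) ∂(A.law (coin p)) := by
  rw [A.lintegral_history_succ _ t hF]
  exact lintegral_congr fun ω => lintegral_arm_coin p _ _

/-- Change of measure: biasing arm `j` from `p` to `q` reweights the law of the history by its
likelihood ratio. -/
theorem lintegral_change_of_measure {p q : unitInterval} (hp : (p : ℝ) ∈ Ioo (0 : ℝ) 1)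
    (hq : (q : ℝ) ∈ Ioo (0 : ℝ) 1) (j : Fin n) (t : ℕ)
    {F : A.Seed × BanditHistory n t → ℝ≥0∞} (hF : Measurable F) :
    ∫⁻ ω, F (ω.1, A.history ω t) ∂(A.law (coin (Function.update (fun _ => p) j q)))
      = ∫⁻ ω, ENNReal.ofReal (likelihoodRatio (p : ℝ) q j (A.history ω t))
          * F (ω.1, A.history ω t) ∂(A.law (coin fun _ => p)) := by
  induction t with
  | zero =>
    have h0 : ∀ ν : BanditInstance n, ∫⁻ ω, F (ω.1, A.history ω 0) ∂(A.law ν)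
        = ∫⁻ s, F (s, fun i => i.elim0) ∂A.seedLaw := by
      intro ν
      have := lintegral_map (μ := A.law ν) (f := fun s => F (s, fun i => i.elim0))
        (hF.comp (measurable_id.prodMk measurable_const)) measurable_fst
      rw [law, Measure.map_fst_prod, measure_univ, one_smul] at this
      exact this.symm
    simp only [likelihoodRatio, Finset.univ_eq_empty, Finset.prod_empty, ENNReal.ofReal_one,
      one_mul]
    rw [h0, h0]
  | succ t ih =>
    have hpull := A.measurable_pull t
    have hP : ∀ f : Fin n → ℝ≥0∞, Measurable fun z : A.Seed × BanditHistory n t =>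
        f (A.pull t z.1 z.2) := fun f => (measurable_of_countable f).comp hpull
    have hG := ((hP fun a => ENNReal.ofReal (Function.update (fun _ => p) j q a)).mul
      (hF.comp (A.measurable_extend 1))).add
      ((hP fun a => ENNReal.ofReal (1 - Function.update (fun _ => p) j q a)).mul
      (hF.comp (A.measurable_extend 0)))
    refine (A.lintegral_coin_history_succ _ t hF).trans ((ih hG).trans ?_)
    have hD : Measurable fun z : A.Seed × BanditHistory n (t + 1) =>
        ENNReal.ofReal (likelihoodRatio (p : ℝ) q j z.2) * F z :=
      (measurable_likelihoodRatio.comp measurable_snd).ennreal_ofReal.mul hF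
    refine Eq.trans ?_ (A.lintegral_coin_history_succ (fun _ => p) t hD).symm
    refine lintegral_congr fun ω => ?_
    set h := A.history ω t
    have hL := (likelihoodRatio_pos (j := j) hp hq h).le
    simp only [Pi.add_apply, Pi.mul_apply, Function.comp_apply, extend, likelihoodRatio_snoc]
    have e1 : ENNReal.ofReal (p : ℝ) * ENNReal.ofReal (likelihoodRatio p q j h *
        if A.pull t ω.1 h = j then coinRatio p q 1 else 1)
        = ENNReal.ofReal (likelihoodRatio p q j h) * ENNReal.ofReal
          (Function.update (fun _ => p) j q (A.pull t ω.1 h) : unitInterval) := by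
      rw [← ENNReal.ofReal_mul hp.1.le, ← ENNReal.ofReal_mul hL]
      congr 1
      have := hp.1.ne'
      by_cases ha : A.pull t ω.1 h = j
      · simp only [ha, if_true, Function.update_self, coinRatio]
        field_simp
      · simp only [ha, if_false, Function.update_of_ne ha]
        ring
    have e0 : ENNReal.ofReal (1 - p : ℝ) * ENNReal.ofReal (likelihoodRatio p q j h *
        if A.pull t ω.1 h = j then coinRatio p q 0 else 1)
        = ENNReal.ofReal (likelihoodRatio p q j h) * ENNReal.ofReal
          (1 - (Function.update (fun _ => p) j q (A.pull t ω.1 h) : unitInterval)) := by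
      rw [← ENNReal.ofReal_mul (sub_nonneg.2 hp.2.le), ← ENNReal.ofReal_mul hL]
      congr 1
      have := (sub_pos.2 hp.2).ne'
      by_cases ha : A.pull t ω.1 h = j
      · simp only [ha, if_true, Function.update_self, coinRatio, zero_ne_one, if_false]
        field_simp
      · simp only [ha, if_false, Function.update_of_ne ha]
        ring
    rw [mul_add, ← mul_assoc, ← mul_assoc, ← mul_assoc, ← mul_assoc, e1, e0]

end RetentionAlgorithm

/-! ### The information inequality for one biased arm -/

namespace RetentionAlgorithm

open BanditInstance

variable {n m : ℕ} (A : RetentionAlgorithm n m)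

/-- The balance of the expected `logDeficit` in round `t`, on the event that the algorithm is
still running: what is lost by stopping now is offset by the divergence gained by pulling `j`. -/
theorem lintegral_logDeficit_succ {p q : unitInterval} (hp : (p : ℝ) ∈ Ioo (0 : ℝ) 1)
    (hq : (q : ℝ) ∈ Ioo (0 : ℝ) 1) (j : Fin n) (t : ℕ) :
    ∫⁻ ω in {ω | ((t + 1 : ℕ) : ℕ∞) ≤ A.stoppingTime ω},
        ENNReal.ofReal (logDeficit (likelihoodRatio (p : ℝ) q j (A.history ω (t + 1))))
        ∂(A.law (coin fun _ => p))
      + ∫⁻ ω in {ω | A.stoppingTime ω = t},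
        ENNReal.ofReal (logDeficit (likelihoodRatio (p : ℝ) q j (A.history ω t)))
        ∂(A.law (coin fun _ => p))
      = ∫⁻ ω in {ω | (t : ℕ∞) ≤ A.stoppingTime ω},
        ENNReal.ofReal (logDeficit (likelihoodRatio (p : ℝ) q j (A.history ω t)))
        ∂(A.law (coin fun _ => p))
      + ENNReal.ofReal (coinKL p q) * A.law (coin fun _ => p)
          {ω | (t : ℕ∞) < A.stoppingTime ω ∧ A.pull t ω.1 (A.history ω t) = j} := by
  set P := A.law (coin fun _ => p)
  have hφ : ∀ u, Measurable fun h : BanditHistory n u =>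
      ENNReal.ofReal (logDeficit (likelihoodRatio (p : ℝ) q j h)) := fun u =>
    (measurable_logDeficit.comp measurable_likelihoodRatio).ennreal_ofReal
  have hφω : ∀ u, Measurable fun ω : A.Sample =>
      ENNReal.ofReal (logDeficit (likelihoodRatio (p : ℝ) q j (A.history ω u))) := fun u =>
    (hφ u).comp (A.measurable_history u)
  have hlt := A.measurableSet_coe_lt_stoppingTime t
  have hpull : MeasurableSet {ω : A.Sample | A.pull t ω.1 (A.history ω t) = j} :=
    A.measurable_pull_history t (measurableSet_singleton j)
  -- The contribution of the runs that continue after round `t`.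
  have hstep : ∫⁻ ω in {ω | ((t + 1 : ℕ) : ℕ∞) ≤ A.stoppingTime ω},
        ENNReal.ofReal (logDeficit (likelihoodRatio (p : ℝ) q j (A.history ω (t + 1)))) ∂P
      = ∫⁻ ω in {ω | (t : ℕ∞) < A.stoppingTime ω},
          ENNReal.ofReal (logDeficit (likelihoodRatio (p : ℝ) q j (A.history ω t))) ∂P
        + ENNReal.ofReal (coinKL p q) *
          P {ω | (t : ℕ∞) < A.stoppingTime ω ∧ A.pull t ω.1 (A.history ω t) = j} := by
    have hF : Measurable fun z : A.Seed × BanditHistory n (t + 1) =>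
        (A.running (t + 1)).indicator
          (fun h => ENNReal.ofReal (logDeficit (likelihoodRatio (p : ℝ) q j h))) z.2 :=
      ((hφ (t + 1)).indicator (A.measurableSet_running (t + 1))).comp measurable_snd
    have h1 := A.lintegral_coin_history_succ (fun _ => p) t hF
    have h2 : ENNReal.ofReal (coinKL p q) *
        P {ω | (t : ℕ∞) < A.stoppingTime ω ∧ A.pull t ω.1 (A.history ω t) = j}
        = ∫⁻ ω, ({ω | (t : ℕ∞) < A.stoppingTime ω ∧
            A.pull t ω.1 (A.history ω t) = j} : Set A.Sample).indicator
            (fun _ => ENNReal.ofReal (coinKL p q)) ω ∂P :=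
      (lintegral_indicator_const (hlt.inter hpull) _).symm
    rw [← lintegral_indicator (A.measurableSet_coe_le_stoppingTime (t + 1)),
      ← lintegral_indicator hlt, h2, ← lintegral_add_left ((hφω t).indicator hlt)]
    refine Eq.trans (lintegral_congr fun ω => ?_) (h1.trans (lintegral_congr fun ω => ?_))
    · simp only [indicator, history_mem_running_iff, mem_ofPred_eq]
    · have hrun : ∀ x : ℝ, (Fin.snoc (α := fun _ => Fin n × ℝ) (A.history ω t)
          (A.pull t ω.1 (A.history ω t), x) : BanditHistory n (t + 1)) ∈ A.running (t + 1)
          ↔ ω ∈ {ω | (t : ℕ∞) < A.stoppingTime ω} := fun x => by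
        rw [snoc_mem_running, history_mem_running_iff, mem_ofPred_eq, coe_lt_stoppingTime_iff]
      by_cases hω : ω ∈ {ω | (t : ℕ∞) < A.stoppingTime ω}
      · simp only [extend]
        rw [indicator_of_mem ((hrun 1).2 hω), indicator_of_mem ((hrun 0).2 hω),
          indicator_of_mem hω]
        simp only [likelihoodRatio_snoc]
        have hL := likelihoodRatio_pos (j := j) hp hq (A.history ω t)
        have hp' := sub_nonneg.2 hp.2.le
        by_cases ha : A.pull t ω.1 (A.history ω t) = j
        · have hm : ω ∈ ({ω | (t : ℕ∞) < A.stoppingTime ω ∧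
            A.pull t ω.1 (A.history ω t) = j} : Set A.Sample) := ⟨hω, ha⟩
          rw [indicator_of_mem hm]
          simp only [ha, if_true]
          rw [← ENNReal.ofReal_mul hp.1.le, ← ENNReal.ofReal_mul hp',
            ← ENNReal.ofReal_add (mul_nonneg hp.1.le (logDeficit_nonneg
              (mul_pos hL (coinRatio_pos hp hq 1)))) (mul_nonneg hp' (logDeficit_nonneg
              (mul_pos hL (coinRatio_pos hp hq 0)))),
            ← ENNReal.ofReal_add (logDeficit_nonneg hL) (coinKL_nonneg hp hq),
            logDeficit_mul_coinRatio hp hq hL]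
        · rw [indicator_of_notMem (s := {ω | (t : ℕ∞) < A.stoppingTime ω ∧
            A.pull t ω.1 (A.history ω t) = j}) fun h => ha h.2]
          simp only [ha, if_false, mul_one, add_zero]
          rw [← add_mul, ← ENNReal.ofReal_add hp.1.le hp', add_sub_cancel, ENNReal.ofReal_one,
            one_mul]
      · simp only [extend]
        rw [indicator_of_notMem fun h => hω ((hrun 1).1 h),
          indicator_of_notMem fun h => hω ((hrun 0).1 h), indicator_of_notMem hω,
          indicator_of_notMem fun h => hω h.1]
        simp
  have hsplit : {ω | (t : ℕ∞) ≤ A.stoppingTime ω}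
      = {ω | (t : ℕ∞) < A.stoppingTime ω} ∪ {ω | A.stoppingTime ω = t} := by
    ext ω
    simp only [mem_ofPred_eq, mem_union, le_iff_lt_or_eq, eq_comm]
  have hdisj : Disjoint {ω | (t : ℕ∞) < A.stoppingTime ω} {ω | A.stoppingTime ω = t} :=
    disjoint_left.2 fun ω h h' => (ne_of_gt h) h'
  rw [hstep, hsplit, lintegral_union (A.measurableSet_stoppingTime_eq_coe t) hdisj]
  ring

/-- The expected `logDeficit` at the stopping time is at most the divergence collected by the
pulls of arm `j`. -/
theorem tsum_lintegral_logDeficit_le {p q : unitInterval} (hp : (p : ℝ) ∈ Ioo (0 : ℝ) 1)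
    (hq : (q : ℝ) ∈ Ioo (0 : ℝ) 1) (j : Fin n) :
    ∑' t : ℕ, ∫⁻ ω in {ω | A.stoppingTime ω = t},
        ENNReal.ofReal (logDeficit (likelihoodRatio (p : ℝ) q j (A.history ω t)))
        ∂(A.law (coin fun _ => p))
      ≤ ENNReal.ofReal (coinKL p q) * ∑' t : ℕ, A.law (coin fun _ => p)
          {ω | (t : ℕ∞) < A.stoppingTime ω ∧ A.pull t ω.1 (A.history ω t) = j} := by
  rw [← ENNReal.tsum_mul_left]
  refine ENNReal.tsum_le_of_sum_range_le fun M => ?_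
  refine le_trans ?_ (ENNReal.sum_le_tsum (Finset.range M))
  refine le_trans le_add_self (b := ∫⁻ ω in {ω | (M : ℕ∞) ≤ A.stoppingTime ω},
        ENNReal.ofReal (logDeficit (likelihoodRatio (p : ℝ) q j (A.history ω M)))
        ∂(A.law (coin fun _ => p)) + _) (le_of_eq ?_)
  induction M with
  | zero => simp [likelihoodRatio, logDeficit]
  | succ M ih =>
    rw [Finset.sum_range_succ, Finset.sum_range_succ, ← ih,
      add_comm (∑ t ∈ Finset.range M, _), ← add_assoc, A.lintegral_logDeficit_succ hp hq j M]
    ring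

/-- A linearized data-processing inequality: if arm `j` is discarded often when all arms are
`p`-coins and rarely when it is a `q`-coin, then it has to be pulled often in the former case. -/
theorem measure_notMem_retained_le {p q : unitInterval} (hp : (p : ℝ) ∈ Ioo (0 : ℝ) 1)
    (hq : (q : ℝ) ∈ Ioo (0 : ℝ) 1) (j : Fin n) {l : ℝ} (hl : l ∈ Ioo (0 : ℝ) 1)
    (hT : ∀ᵐ ω ∂(A.law (coin fun _ => p)), A.stoppingTime ω ≠ ⊤) :
    ENNReal.ofReal (-Real.log l) * A.law (coin fun _ => p) {ω | j ∉ A.retained ω}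
      ≤ ENNReal.ofReal (coinKL p q) * ∑' t : ℕ, A.law (coin fun _ => p)
          {ω | (t : ℕ∞) < A.stoppingTime ω ∧ A.pull t ω.1 (A.history ω t) = j}
        + ENNReal.ofReal (1 / l - 1) *
          A.law (coin (Function.update (fun _ => p) j q)) {ω | j ∉ A.retained ω} := by
  set P := A.law (coin fun _ => p)
  set Q := A.law (coin (Function.update (fun _ => p) j q))
  set B : ℕ → Set A.Sample := fun t => {ω | A.stoppingTime ω = t} ∩ {ω | j ∉ A.retained ω}
  have hB : ∀ t, MeasurableSet (B t) := fun t =>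
    (A.measurableSet_stoppingTime_eq_coe t).inter (A.measurableSet_mem_retained j).compl
  have hBdisj : Pairwise (Function.onFun Disjoint B) := fun s t hst =>
    disjoint_left.2 fun ω h h' => hst (by
      have := h.1.symm.trans h'.1
      exact_mod_cast this)
  -- In terms of the history, `B t` is the event that the run ends now and discards `j`.
  let H : (t : ℕ) → Set (A.Seed × BanditHistory n t) := fun t =>
    {z | (z.2 ∈ A.running t ∧ z.2 ∈ A.haltSet t) ∧ j ∉ A.output t z.1 z.2}
  have hH : ∀ t, MeasurableSet (H t) := fun t =>
    ((measurable_snd (A.measurableSet_running t)).inter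
      (measurable_snd (A.measurableSet_haltSet t))).inter (A.measurableSet_output t j).compl
  have hBH : ∀ t ω, (ω.1, A.history ω t) ∈ H t ↔ ω ∈ B t := by
    intro t ω
    simp only [H, B, mem_ofPred_eq, mem_inter_iff, history_mem_running_iff,
      ← stoppingTime_eq_coe_iff]
    refine and_congr_right fun h => ?_
    have hout : ∀ N : ℕ∞, N = t → A.output N.toNat ω.1 (A.history ω N.toNat)
        = A.output t ω.1 (A.history ω t) := by
      rintro _ rfl; rfl
    rw [retained, hout _ h]
  have hPsum : P {ω | j ∉ A.retained ω} = ∑' t, P (B t) := by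
    rw [← measure_iUnion hBdisj hB]
    refine measure_congr ?_
    filter_upwards [hT] with ω hω
    refine propext ⟨fun h => ?_, fun h => ?_⟩
    · obtain ⟨t, ht⟩ := ENat.ne_top_iff_exists.1 hω
      exact mem_iUnion.2 ⟨t, ht.symm, h⟩
    · obtain ⟨t, ht⟩ := mem_iUnion.1 h
      exact ht.2
  have hQsum : ∑' t, Q (B t) ≤ Q {ω | j ∉ A.retained ω} := by
    rw [← measure_iUnion hBdisj hB]
    exact measure_mono (iUnion_subset fun t => inter_subset_right)
  have hchange : ∀ t, Q (B t) = ∫⁻ ω in B t,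
      ENNReal.ofReal (likelihoodRatio (p : ℝ) q j (A.history ω t)) ∂P := by
    intro t
    have h := A.lintegral_change_of_measure hp hq j t (measurable_one.indicator (hH t))
    have e : ∀ ω : A.Sample,
        (H t).indicator (1 : A.Seed × BanditHistory n t → ℝ≥0∞) (ω.1, A.history ω t)
          = (B t).indicator 1 ω := fun ω => by
      by_cases hω : ω ∈ B t
      · rw [indicator_of_mem hω, indicator_of_mem ((hBH t ω).2 hω)]; rfl
      · rw [indicator_of_notMem hω, indicator_of_notMem fun h => hω ((hBH t ω).1 h)]
    simp only [e] at h
    rw [lintegral_indicator_one (hB t)] at h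
    rw [h, ← lintegral_indicator (hB t)]
    refine lintegral_congr fun ω => ?_
    by_cases hω : ω ∈ B t
    · simp [indicator_of_mem hω]
    · simp [indicator_of_notMem hω]
  have hround : ∀ t : ℕ, ENNReal.ofReal (-Real.log l) * P (B t)
      ≤ ∫⁻ ω in {ω | A.stoppingTime ω = t},
        ENNReal.ofReal (logDeficit (likelihoodRatio (p : ℝ) q j (A.history ω t))) ∂P
        + ENNReal.ofReal (1 / l - 1) * Q (B t) := by
    intro t
    have hl' : 0 ≤ 1 / l - 1 := by
      rw [sub_nonneg, le_div_iff₀ hl.1]; linarith [hl.2]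
    have hm : Measurable fun ω : A.Sample =>
        ENNReal.ofReal (likelihoodRatio (p : ℝ) q j (A.history ω t)) :=
      ((measurable_likelihoodRatio (p := p) (q := q) (j := j)).comp
        (A.measurable_history t)).ennreal_ofReal
    rw [hchange, ← lintegral_const_mul _ hm, ← setLIntegral_const]
    refine le_trans ?_ (add_le_add_left (lintegral_mono_set (s := B t) inter_subset_left) _)
    rw [← lintegral_add_right _ (hm.const_mul _)]
    refine lintegral_mono fun ω => ?_
    have hL := likelihoodRatio_pos (j := j) hp hq (A.history ω t)
    rw [← ENNReal.ofReal_mul hl', ← ENNReal.ofReal_add (logDeficit_nonneg hL)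
      (mul_nonneg hl' hL.le)]
    exact ENNReal.ofReal_le_ofReal (neg_log_le_logDeficit_add hl.1 hL)
  calc ENNReal.ofReal (-Real.log l) * P {ω | j ∉ A.retained ω}
      = ∑' t, ENNReal.ofReal (-Real.log l) * P (B t) := by rw [hPsum, ENNReal.tsum_mul_left]
    _ ≤ _ := ENNReal.tsum_le_tsum hround
    _ = _ := by rw [ENNReal.tsum_add, ENNReal.tsum_mul_left]
    _ ≤ _ := add_le_add (A.tsum_lintegral_logDeficit_le hp hq j) (mul_le_mul_right hQsum _)

end RetentionAlgorithm

/-! ### The lower bound -/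

namespace BanditInstance

/-- If arm `j` is the only one with a coin better than `p`, the gap is paid exactly when `j` is
discarded. -/
theorem gap_coin_update {n : ℕ} {p q : unitInterval} (hpq : p ≤ q) (j : Fin n)
    {S : Finset (Fin n)} (hS : S.Nonempty) :
    (coin (Function.update (fun _ => p) j q)).gap S
      = if j ∈ S then 0 else (q : ℝ) - p := by
  have : Nonempty (Fin n) := ⟨j⟩
  have : Nonempty {i // i ∈ S} := hS.to_subtype
  have hle : ∀ i, ((Function.update (fun _ => p) j q i : unitInterval) : ℝ) ≤ q := fun i => by
    by_cases h : i = j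
    · subst h; simp
    · simpa [Function.update_of_ne h] using hpq
  have htop : (⨆ i : Fin n, ((Function.update (fun _ => p) j q i : unitInterval) : ℝ)) = q := by
    refine le_antisymm (ciSup_le hle) ?_
    have := le_ciSup (f := fun i : Fin n =>
      ((Function.update (fun _ => p) j q i : unitInterval) : ℝ)) (finite_range _).bddAbove j
    simpa using this
  simp only [gap, mean_coin, htop]
  by_cases hj : j ∈ S
  · rw [if_pos hj, sub_eq_zero]
    refine le_antisymm ?_ (ciSup_le fun i => hle i)
    have := le_ciSup (f := fun i : {i // i ∈ S} =>
      ((Function.update (fun _ => p) j q i : unitInterval) : ℝ)) (finite_range _).bddAbove ⟨j, hj⟩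
    simpa using this
  · rw [if_neg hj]
    congr 1
    have : ∀ i : {i // i ∈ S},
        ((Function.update (fun _ => p) j q i : unitInterval) : ℝ) = p := fun i => by
      rw [Function.update_of_ne]
      rintro h
      exact hj (h ▸ i.2)
    simp only [this, ciSup_const]

end BanditInstance

namespace RetentionAlgorithm

open BanditInstance

variable {n m : ℕ} (A : RetentionAlgorithm n m)

/-- A good algorithm rarely discards the only good arm. -/
theorem SolvesRBAR.measure_notMem_retained_le {A : RetentionAlgorithm n m} {r : ℝ}
    (hA : A.SolvesRBAR r) (hm : 1 ≤ m) {p q : unitInterval} (hpq : p < q) (j : Fin n) :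
    A.law (coin (Function.update (fun _ => p) j q)) {ω | j ∉ A.retained ω}
      ≤ ENNReal.ofReal (r / (q - p)) := by
  set Q := A.law (coin (Function.update (fun _ => p) j q))
  have hd : (0 : ℝ) < q - p := sub_pos.2 hpq
  have h := (hA (coin (Function.update (fun _ => p) j q))).2
  have hms : MeasurableSet {ω | j ∉ A.retained ω} := (A.measurableSet_mem_retained j).compl
  have hgap : ∀ ω, (coin (Function.update (fun _ => p) j q)).gap (A.retained ω)
      = {ω | j ∉ A.retained ω}.indicator (fun _ => (q : ℝ) - p) ω := by
    intro ω
    rw [gap_coin_update hpq.le j (Finset.card_pos.1 (by rw [A.card_retained]; exact hm))]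
    by_cases hj : j ∈ A.retained ω <;> simp [indicator, hj]
  simp only [hgap] at h
  rw [integral_indicator_const _ hms, smul_eq_mul, ← lt_div_iff₀ hd] at h
  rw [← ofReal_measureReal]
  exact ENNReal.ofReal_le_ofReal h.le

theorem sum_measure_notMem_retained (hmn : m ≤ n) (ν : BanditInstance n) :
    ∑ j, A.law ν {ω | j ∉ A.retained ω} = ENNReal.ofReal ((n : ℝ) - m) := by
  have hms : ∀ j, MeasurableSet {ω | j ∉ A.retained ω} := fun j =>
    (A.measurableSet_mem_retained j).compl
  have h : ∀ ω, ∑ j, {ω | j ∉ A.retained ω}.indicator (1 : A.Sample → ℝ≥0∞) ω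
      = ENNReal.ofReal ((n : ℝ) - m) := by
    intro ω
    have h1 : ∑ j, {ω | j ∉ A.retained ω}.indicator (1 : A.Sample → ℝ≥0∞) ω
        = ((A.retained ω)ᶜ.card : ℝ≥0∞) := by
      rw [Finset.card_eq_sum_ones, Nat.cast_sum, ← Finset.sum_subset (Finset.subset_univ _)]
      · refine Finset.sum_congr rfl fun j hj => ?_
        rw [indicator_of_mem]
        · simp
        · exact Finset.mem_compl.1 hj
      · intro j _ hj
        exact indicator_of_notMem (fun h => hj (Finset.mem_compl.2 h)) _
    rw [h1, Finset.card_compl, Fintype.card_fin, A.card_retained, ← Nat.cast_sub hmn,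
      ENNReal.ofReal_natCast]
  have hint := lintegral_congr (μ := A.law ν) h
  rw [lintegral_const, measure_univ, mul_one,
    lintegral_finsetSum _ fun j _ => measurable_one.indicator (hms j)] at hint
  rw [← hint]
  exact Finset.sum_congr rfl fun j _ => (lintegral_indicator_one (hms j)).symm

/-- Every round before the stopping time pulls exactly one arm. -/
theorem sum_tsum_measure_pull (ν : BanditInstance n) :
    ∑ j, ∑' t : ℕ, A.law ν
        {ω | (t : ℕ∞) < A.stoppingTime ω ∧ A.pull t ω.1 (A.history ω t) = j}
      = A.expectedSamples ν := by
  rw [expectedSamples_eq_tsum, ← Summable.tsum_finsetSum fun _ _ => ENNReal.summable]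
  refine tsum_congr fun t => ?_
  rw [← measure_biUnion_finset]
  · congr 1
    ext ω
    simp
  · intro i _ j _ hij
    exact disjoint_left.2 fun ω h h' => hij (h.2.symm.trans h'.2)
  · exact fun j _ => (A.measurableSet_coe_lt_stoppingTime t).inter
      (A.measurable_pull_history t (measurableSet_singleton j))

/-- The information inequality summed over all arms: the pulls before the stopping time have to pay
for the discarded arms. -/
theorem SolvesRBAR.le_coinKL_mul_expectedSamples {A : RetentionAlgorithm n m} {r : ℝ}
    (hA : A.SolvesRBAR r) (hm : 1 ≤ m) (hmn : m < n) {p q : unitInterval}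
    (hp : (p : ℝ) ∈ Ioo (0 : ℝ) 1) (hq : (q : ℝ) ∈ Ioo (0 : ℝ) 1) (hpq : p < q) {b : ℝ}
    (hb : b ∈ Ioo (0 : ℝ) 1) (hrb : n * (r / (q - p)) ≤ (1 - b) * ((n : ℝ) - m)) :
    ENNReal.ofReal ((-Real.log (1 - b) - b) * ((n : ℝ) - m))
      ≤ ENNReal.ofReal (coinKL p q) * A.expectedSamples (coin fun _ => p) := by
  have hd : (0 : ℝ) < q - p := sub_pos.2 hpq
  have hl : 1 - b ∈ Ioo (0 : ℝ) 1 := ⟨by linarith [hb.2], by linarith [hb.1]⟩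
  have hk : (0 : ℝ) ≤ (n : ℝ) - m := sub_nonneg.2 (Nat.cast_le.2 hmn.le)
  have hlog : 0 ≤ -Real.log (1 - b) := neg_nonneg.2 (Real.log_nonpos hl.1.le hl.2.le)
  have hcoef : 0 ≤ 1 / (1 - b) - 1 := by
    rw [sub_nonneg, le_div_iff₀ hl.1]; linarith [hl.2]
  have h := Finset.sum_le_sum fun (j : Fin n) (_ : j ∈ Finset.univ) =>
    (A.measure_notMem_retained_le hp hq j hl (hA _).1).trans (add_le_add_right
      (mul_le_mul_right (hA.measure_notMem_retained_le hm hpq j) _) _)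
  rw [Finset.sum_add_distrib, ← Finset.mul_sum, ← Finset.mul_sum, A.sum_tsum_measure_pull,
    A.sum_measure_notMem_retained hmn.le, Finset.sum_const, Finset.card_univ, Fintype.card_fin,
    nsmul_eq_mul, ← ENNReal.ofReal_mul hlog, ← ENNReal.ofReal_mul hcoef,
    ← ENNReal.ofReal_natCast, ← ENNReal.ofReal_mul (Nat.cast_nonneg n)] at h
  rw [sub_mul, ENNReal.ofReal_sub _ (mul_nonneg hb.1.le hk), tsub_le_iff_right]
  refine h.trans (add_le_add_right (ENNReal.ofReal_le_ofReal ?_) _)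
  calc (n : ℝ) * ((1 / (1 - b) - 1) * (r / (q - p)))
      = (1 / (1 - b) - 1) * (n * (r / (q - p))) := by ring
    _ ≤ (1 / (1 - b) - 1) * ((1 - b) * ((n : ℝ) - m)) := mul_le_mul_of_nonneg_left hrb hcoef
    _ = b * ((n : ℝ) - m) := by
      have := hl.1.ne'
      field_simp
      ring

end RetentionAlgorithm

/-- The constant of the lower bound is positive. -/
theorem neg_log_one_sub_sub_pos {b : ℝ} (hb : b ∈ Ioo (0 : ℝ) 1) : 0 < -Real.log (1 - b) - b := by
  have := Real.log_lt_sub_one_of_pos (sub_pos.2 hb.2) (by linarith [hb.1])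
  linarith

theorem le_sampleComplexityRBAR {β : ℝ} (hβ : β ∈ Ioo (0 : ℝ) 1) {n m : ℕ} {r : ℝ} (hm : 1 ≤ m)
    (hmn : m < n) (hr : 0 < r) (hrβ : r ≤ (1 - β) * (((n : ℝ) - m) / n)) :
    ENNReal.ofReal ((-Real.log (1 - β / 2) - β / 2) * (β * (1 - β / 2) / 4) ^ 2
        * (((n : ℝ) - m) ^ 3 / (n * r) ^ 2))
      ≤ sampleComplexityRBAR n m r := by
  obtain ⟨hβ0, hβ1⟩ := hβ
  have hk : (0 : ℝ) < (n : ℝ) - m := sub_pos.2 (Nat.cast_lt.2 hmn)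
  have hn : (0 : ℝ) < n := Nat.cast_pos.2 (by omega)
  have hb : β / 2 ∈ Ioo (0 : ℝ) 1 := ⟨by linarith, by linarith⟩
  have hb' : 0 < 1 - β / 2 := by linarith
  -- The gap that makes the retention error of blind guessing exceed `r` by a constant factor.
  set d : ℝ := n * r / (((n : ℝ) - m) * (1 - β / 2)) with hd
  have hd0 : 0 < d := div_pos (mul_pos hn hr) (mul_pos hk hb')
  have hd1 : d ≤ 1 - β / 2 := by
    rw [hd, div_le_iff₀ (mul_pos hk hb')]
    have h1 : n * r ≤ (1 - β) * ((n : ℝ) - m) := by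
      calc n * r ≤ n * ((1 - β) * (((n : ℝ) - m) / n)) := mul_le_mul_of_nonneg_left hrβ hn.le
        _ = (1 - β) * ((n : ℝ) - m) := by field_simp
    nlinarith [mul_pos hk (mul_pos hβ0 hβ0)]
  let p : unitInterval := ⟨β / 4, by linarith, by linarith⟩
  let q : unitInterval := ⟨β / 4 + d, by linarith, by linarith⟩
  have hp : (p : ℝ) ∈ Ioo (0 : ℝ) 1 := ⟨by simp only [p]; linarith, by simp only [p]; linarith⟩
  have hq : (q : ℝ) ∈ Ioo (0 : ℝ) 1 := ⟨by simp only [q]; linarith, by simp only [q]; linarith⟩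
  have hpq : p < q := by
    rw [← Subtype.coe_lt_coe]; simp only [p, q]; linarith
  have hqp : (q : ℝ) - p = d := by simp [p, q]
  have hkl : coinKL p q ≤ d ^ 2 / (β / 4) ^ 2 := by
    refine (coinKL_le hp hq).trans ?_
    rw [hqp]
    refine div_le_div_of_nonneg_left (sq_nonneg d) (by positivity) ?_
    rw [sq]
    exact mul_le_mul (by simp only [q]; linarith) (by simp only [q]; linarith) (by positivity)
      hq.1.le
  refine le_iInf₂ fun A hA => le_trans ?_ (le_iSup _ (BanditInstance.coin fun _ => p))
  have h := hA.le_coinKL_mul_expectedSamples hm hmn hp hq hpq hb (by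
    rw [hqp, hd]
    refine le_of_eq ?_
    field_simp)
  have h2 := h.trans (mul_le_mul_left (ENNReal.ofReal_le_ofReal hkl) _)
  have hK : 0 < d ^ 2 / (β / 4) ^ 2 := by positivity
  have e : (-Real.log (1 - β / 2) - β / 2) * (β * (1 - β / 2) / 4) ^ 2
        * (((n : ℝ) - m) ^ 3 / (n * r) ^ 2)
      = (-Real.log (1 - β / 2) - β / 2) * ((n : ℝ) - m) / (d ^ 2 / (β / 4) ^ 2) := by
    rw [hd]
    field_simp
  rw [e, ENNReal.ofReal_div_of_pos hK]
  exact ENNReal.div_le_of_le_mul' h2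

/-! ### Means, gaps and empirical means -/

namespace BanditInstance

variable {n : ℕ} (ν : BanditInstance n)

theorem mean_mem_Icc (i : Fin n) : ν.mean i ∈ Icc (0 : ℝ) 1 := by
  have hb := ν.bounded_arm i
  refine ⟨integral_nonneg_of_ae (hb.mono fun x hx => hx.1), ?_⟩
  have hi : Integrable (fun x : ℝ => x) (ν.arm i) :=
    Integrable.of_mem_Icc 0 1 aemeasurable_id hb
  calc ν.mean i ≤ ∫ _, (1 : ℝ) ∂(ν.arm i) :=
        integral_mono_ae hi (integrable_const _) (hb.mono fun x hx => hx.2)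
    _ = 1 := by simp

theorem mean_le_iSup (i : Fin n) : ν.mean i ≤ ⨆ j, ν.mean j :=
  le_ciSup (finite_range _).bddAbove i

theorem gap_nonneg {S : Finset (Fin n)} (hS : S.Nonempty) : 0 ≤ ν.gap S := by
  have : Nonempty {i // i ∈ S} := hS.to_subtype
  exact sub_nonneg.2 (ciSup_le fun i => ν.mean_le_iSup i)

theorem gap_le_of_mem {S : Finset (Fin n)} {i : Fin n} (hi : i ∈ S) :
    ν.gap S ≤ (⨆ j, ν.mean j) - ν.mean i :=
  sub_le_sub_left
    (le_ciSup (f := fun i : {i // i ∈ S} => ν.mean i) (finite_range _).bddAbove ⟨i, hi⟩) _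

theorem gap_le_one {S : Finset (Fin n)} (hS : S.Nonempty) : ν.gap S ≤ 1 := by
  obtain ⟨i, hi⟩ := hS
  have : Nonempty (Fin n) := ⟨i⟩
  have h1 : ⨆ j, ν.mean j ≤ 1 := ciSup_le fun j => (ν.mean_mem_Icc j).2
  linarith [ν.gap_le_of_mem hi, (ν.mean_mem_Icc i).1]

theorem ae_reward_mem_Icc (t : ℕ) (i : Fin n) : ∀ᵐ x ∂ν.rewardLaw, x t i ∈ Icc (0 : ℝ) 1 :=
  (ν.measurePreserving_eval t i).quasiMeasurePreserving.ae (ν.bounded_arm i)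

theorem memLp_reward (t : ℕ) (i : Fin n) :
    MemLp (fun x : ℕ → Fin n → ℝ => x t i) 2 ν.rewardLaw :=
  memLp_of_bounded (ν.ae_reward_mem_Icc t i)
    (ν.measurePreserving_eval t i).measurable.aestronglyMeasurable _

theorem integral_reward (t : ℕ) (i : Fin n) : ∫ x, x t i ∂ν.rewardLaw = ν.mean i := by
  have h := ν.measurePreserving_eval t i
  rw [mean, ← h.map_eq]
  exact (integral_map (f := fun y : ℝ => y) h.measurable.aemeasurable
    measurable_id.aestronglyMeasurable).symm

theorem indepFun_reward {s t : ℕ} (hst : s ≠ t) (i : Fin n) :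
    ProbabilityTheory.IndepFun (fun x : ℕ → Fin n → ℝ => x s i) (fun x => x t i)
      ν.rewardLaw :=
  (ProbabilityTheory.iIndepFun_infinitePi (P := fun _ : ℕ => Measure.pi ν.arm)
    (X := fun _ row => row i) fun _ => measurable_pi_apply i).indepFun hst

/-- The mean absolute error of the empirical mean of `w ^ 2` rewards is at most `1 / w`. -/
theorem lintegral_abs_empiricalMean_sub_mean_le (i : Fin n) (t : ℕ) {w : ℕ} (hw : 0 < w) :
    ∫⁻ x, ENNReal.ofReal |(∑ v ∈ Finset.range (w ^ 2), x (t + v) i) / (w : ℝ) ^ 2 - ν.mean i|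
        ∂ν.rewardLaw ≤ ENNReal.ofReal (1 / w) := by
  have hw' : (0 : ℝ) < w := Nat.cast_pos.2 hw
  set S : (ℕ → Fin n → ℝ) → ℝ := fun x => ∑ v ∈ Finset.range (w ^ 2), x (t + v) i with hS
  have hSL : MemLp S 2 ν.rewardLaw := memLp_finsetSum _ fun v _ => ν.memLp_reward (t + v) i
  have hSmean : ∫ x, S x ∂ν.rewardLaw = (w : ℝ) ^ 2 * ν.mean i := by
    rw [hS, integral_finsetSum _ fun v _ => (ν.memLp_reward (t + v) i).integrable one_le_two]
    simp [integral_reward]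
  have hvar : ProbabilityTheory.variance S ν.rewardLaw ≤ (w : ℝ) ^ 2 := by
    have hsum : S = ∑ v ∈ Finset.range (w ^ 2), fun x : ℕ → Fin n → ℝ => x (t + v) i := by
      ext x; simp [hS]
    rw [hsum, ProbabilityTheory.IndepFun.variance_sum fun v _ => ν.memLp_reward (t + v) i]
    · calc _ ≤ ∑ _v ∈ Finset.range (w ^ 2), (1 : ℝ) := Finset.sum_le_sum fun v _ =>
            (ProbabilityTheory.variance_le_sq_of_bounded (ν.ae_reward_mem_Icc (t + v) i)
              (ν.measurePreserving_eval (t + v) i).measurable.aemeasurable).trans (by norm_num)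
        _ = _ := by simp
    · intro u _ v _ huv
      exact ν.indepFun_reward (by simpa using huv) i
  have hsq : ∫ x, (S x - (w : ℝ) ^ 2 * ν.mean i) ^ 2 ∂ν.rewardLaw ≤ (w : ℝ) ^ 2 := by
    rwa [ProbabilityTheory.variance_eq_integral hSL.aestronglyMeasurable.aemeasurable,
      hSmean] at hvar
  have hint : Integrable (fun x => (S x - (w : ℝ) ^ 2 * ν.mean i) ^ 2) ν.rewardLaw :=
    (hSL.sub (memLp_const _)).integrable_sq
  -- The arithmetic–geometric mean inequality reduces the first moment to the variance.
  have hpt : ∀ x, |S x / (w : ℝ) ^ 2 - ν.mean i|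
      ≤ (S x - (w : ℝ) ^ 2 * ν.mean i) ^ 2 / (2 * w ^ 3) + 1 / (2 * w) := by
    intro x
    have e : S x / (w : ℝ) ^ 2 - ν.mean i = (S x - (w : ℝ) ^ 2 * ν.mean i) / w ^ 2 := by
      field_simp
    rw [e, abs_div, abs_of_pos (by positivity : (0 : ℝ) < w ^ 2),
      ← sq_abs (S x - (w : ℝ) ^ 2 * ν.mean i)]
    set z := |S x - (w : ℝ) ^ 2 * ν.mean i|
    have : z ^ 2 / (2 * w ^ 3) + 1 / (2 * w) - z / w ^ 2 = (z - w) ^ 2 / (2 * w ^ 3) := by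
      field_simp
      ring
    have : 0 ≤ (z - w) ^ 2 / (2 * (w : ℝ) ^ 3) := by positivity
    linarith
  calc _ ≤ ∫⁻ x, ENNReal.ofReal ((S x - (w : ℝ) ^ 2 * ν.mean i) ^ 2 / (2 * w ^ 3) + 1 / (2 * w))
          ∂ν.rewardLaw := lintegral_mono fun x => ENNReal.ofReal_le_ofReal (hpt x)
    _ = ENNReal.ofReal (∫ x, ((S x - (w : ℝ) ^ 2 * ν.mean i) ^ 2 / (2 * w ^ 3) + 1 / (2 * w))
          ∂ν.rewardLaw) := by
      rw [ofReal_integral_eq_lintegral_ofReal]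
      · exact (hint.div_const _).add (integrable_const _)
      · exact ae_of_all _ fun x => by positivity
    _ ≤ ENNReal.ofReal (1 / w) := by
      refine ENNReal.ofReal_le_ofReal ?_
      rw [integral_add (hint.div_const _) (integrable_const _), integral_div]
      simp only [integral_const, probReal_univ, one_smul]
      calc _ ≤ (w : ℝ) ^ 2 / (2 * w ^ 3) + 1 / (2 * w) := by gcongr
        _ = 1 / w := by field_simp; ring

end BanditInstance

/-! ### Algorithms with a fixed horizon -/

/-- The rewards recorded in a history, continued by zeros. -/
def rewardSeq {n t : ℕ} (h : BanditHistory n t) (u : ℕ) : ℝ :=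
  if hu : u < t then (h ⟨u, hu⟩).2 else 0

theorem measurable_rewardSeq {n t : ℕ} :
    Measurable (rewardSeq : BanditHistory n t → ℕ → ℝ) := by
  refine measurable_pi_lambda _ fun u => ?_
  unfold rewardSeq
  by_cases hu : u < t
  · simp only [hu, dif_pos]; exact (measurable_pi_apply _).snd
  · simp only [hu, dif_neg, not_false_iff]; exact measurable_const

/-- The uniform distribution on the arms. -/
noncomputable def uniformArm (n : ℕ) : Measure (Fin n) := (n : ℝ≥0∞)⁻¹ • Measure.count

theorem lintegral_uniformArm {n : ℕ} (f : Fin n → ℝ≥0∞) :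
    ∫⁻ s, f s ∂(uniformArm n) = (n : ℝ≥0∞)⁻¹ * ∑ s, f s := by
  rw [uniformArm, lintegral_smul_measure, lintegral_count, tsum_fintype, smul_eq_mul]

instance (n : ℕ) [NeZero n] : IsProbabilityMeasure (uniformArm n) := by
  refine ⟨?_⟩
  have h : (n : ℝ≥0∞) ≠ 0 := Nat.cast_ne_zero.2 (NeZero.ne n)
  simp [uniformArm, Measure.count_apply_finite, ENNReal.inv_mul_cancel h (ENNReal.natCast_ne_top n)]

/-- The cyclic window of `N` arms that starts at `s`. -/
def cyclicWindow {n : ℕ} [NeZero n] (N : ℕ) (s : Fin n) : Finset (Fin n) :=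
  Finset.univ.filter fun i => (i - s).val < N

theorem mem_cyclicWindow {n : ℕ} [NeZero n] {N : ℕ} {s i : Fin n} :
    i ∈ cyclicWindow N s ↔ (i - s).val < N := by
  simp [cyclicWindow]

theorem card_filter_val_lt {n N : ℕ} (h : N ≤ n) :
    (Finset.univ.filter fun i : Fin n => i.val < N).card = N := by
  rw [Fin.card_filter_val_lt, min_eq_right h]

theorem card_cyclicWindow {n : ℕ} [NeZero n] {N : ℕ} (h : N ≤ n) (s : Fin n) :
    (cyclicWindow N s).card = N := by
  refine (Finset.card_equiv (Equiv.subRight s) fun i => ?_).trans (card_filter_val_lt h)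
  simp [cyclicWindow]

/-- A random cyclic window of `N` arms contains any given arm with probability `N / n`. -/
theorem lintegral_mem_cyclicWindow {n : ℕ} [NeZero n] {N : ℕ} (h : N ≤ n) (a : Fin n)
    (B : ℝ≥0∞) :
    ∫⁻ s, (if a ∈ cyclicWindow N s then B else 0) ∂(uniformArm n)
      = (n : ℝ≥0∞)⁻¹ * (N * B) := by
  rw [lintegral_uniformArm, ← Finset.sum_filter, Finset.sum_const, nsmul_eq_mul]
  congr 3
  refine (Finset.card_equiv (Equiv.subLeft a) fun i => ?_).trans (card_filter_val_lt h)
  simp [mem_cyclicWindow]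

namespace RetentionAlgorithm

variable {n m : ℕ}

/-- The reward received in round `t`. -/
def reward (A : RetentionAlgorithm n m) (ω : A.Sample) (t : ℕ) : ℝ :=
  ω.2 t (A.pull t ω.1 (A.history ω t))

theorem rewardSeq_history (A : RetentionAlgorithm n m) (ω : A.Sample) {t u : ℕ} (hu : u < t) :
    rewardSeq (A.history ω t) u = A.reward ω u := by
  induction t with
  | zero => exact absurd hu (Nat.not_lt_zero u)
  | succ t ih =>
    rw [rewardSeq, dif_pos hu, history_succ]
    rcases Nat.lt_succ_iff_lt_or_eq.1 hu with h | rfl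
    · rw [← ih h, rewardSeq, dif_pos h]
      exact congrArg Prod.snd (Fin.snoc_castSucc (α := fun _ => Fin n × ℝ) _ (A.history ω t) ⟨u, h⟩)
    · exact congrArg Prod.snd (Fin.snoc_last (α := fun _ => Fin n × ℝ) _ (A.history ω u))

theorem reward_congr (A : RetentionAlgorithm n m) (s : A.Seed) {x y : ℕ → Fin n → ℝ} {t u : ℕ}
    (h : ∀ u < t, x u = y u) (hu : u < t) : A.reward (s, x) u = A.reward (s, y) u := by
  simp only [reward, h u hu, A.history_congr s fun v hv => h v (hv.trans hu)]

theorem measurable_reward (A : RetentionAlgorithm n m) : Measurable A.reward := by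
  refine measurable_pi_lambda _ fun t => ?_
  have : Measurable fun p : Fin n × A.Sample => p.2.2 t p.1 :=
    measurable_from_prod_countable_right fun i =>
      (measurable_pi_apply i).comp ((measurable_pi_apply t).comp measurable_snd)
  exact this.comp ((A.measurable_pull_history t).prodMk measurable_id)

/-- The algorithm that stops after exactly `τ` rounds.  Its seed is a uniformly random arm `s`, and
its decisions depend on `s` and on the rewards seen so far (continued by zeros). -/
noncomputable def fixedHorizon [NeZero n] (τ : ℕ) (pull : ℕ → Fin n → (ℕ → ℝ) → Fin n)
    (hpull : ∀ t s, Measurable (pull t s)) (out : Fin n → (ℕ → ℝ) → Finset (Fin n))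
    (hcard : ∀ s y, (out s y).card = m) (hout : ∀ s i, MeasurableSet {y | i ∈ out s y}) :
    RetentionAlgorithm n m where
  Seed := Fin n
  measurableSpaceSeed := inferInstance
  seedLaw := uniformArm n
  isProbabilityMeasure_seedLaw := inferInstance
  pull t s h := pull t s (rewardSeq h)
  measurable_pull t := measurable_from_prod_countable_right fun s =>
    (hpull t s).comp measurable_rewardSeq
  haltSet t := {_h | t = τ}
  measurableSet_haltSet _ := MeasurableSet.const _
  output _ s h := out s (rewardSeq h)
  card_output _ s h := hcard s _
  measurableSet_output t i := by
    have h : ∀ s, MeasurableSet {h : BanditHistory n t | i ∈ out s (rewardSeq h)} := fun s =>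
      measurable_rewardSeq (hout s i)
    have : {p : Fin n × BanditHistory n t | i ∈ out p.1 (rewardSeq p.2)}
        = ⋃ s, {s} ×ˢ {h : BanditHistory n t | i ∈ out s (rewardSeq h)} := by
      ext p
      simp
    rw [this]
    exact MeasurableSet.iUnion fun s => (measurableSet_singleton s).prod (h s)

section FixedHorizon

variable [NeZero n] {τ : ℕ} {pull : ℕ → Fin n → (ℕ → ℝ) → Fin n}
  {hpull : ∀ t s, Measurable (pull t s)} {out : Fin n → (ℕ → ℝ) → Finset (Fin n)}
  {hcard : ∀ s y, (out s y).card = m} {hout : ∀ s i, MeasurableSet {y | i ∈ out s y}}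

theorem stoppingTime_fixedHorizon
    (ω : (fixedHorizon τ pull hpull out hcard hout).Sample) :
    (fixedHorizon τ pull hpull out hcard hout).stoppingTime ω = τ := by
  simp [stoppingTime, fixedHorizon]

theorem expectedSamples_fixedHorizon (ν : BanditInstance n) :
    (fixedHorizon τ pull hpull out hcard hout).expectedSamples ν = τ := by
  simp [expectedSamples, stoppingTime_fixedHorizon]

theorem retained_fixedHorizon
    (ω : (fixedHorizon τ pull hpull out hcard hout).Sample) :
    (fixedHorizon τ pull hpull out hcard hout).retained ω
      = out ω.1 (rewardSeq ((fixedHorizon τ pull hpull out hcard hout).history ω τ)) := by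
  have h : ∀ N : ℕ∞, N = τ → (fixedHorizon τ pull hpull out hcard hout).output N.toNat ω.1
      ((fixedHorizon τ pull hpull out hcard hout).history ω N.toNat)
      = out ω.1 (rewardSeq ((fixedHorizon τ pull hpull out hcard hout).history ω τ)) := by
    rintro _ rfl; rfl
  exact h _ (stoppingTime_fixedHorizon ω)

/-- A fixed-horizon algorithm solves `r`-BAR as soon as the gap has an upper bound, measurable in
the rewards, whose mean is less than `r`. -/
theorem solvesRBAR_fixedHorizon {r : ℝ} (hr : 0 < r) (hm : 1 ≤ m)
    (h : ∀ ν : BanditInstance n, ∃ g : Fin n → (ℕ → Fin n → ℝ) → ℝ≥0∞,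
      (∀ s, Measurable (g s)) ∧
      (∀ s x, ENNReal.ofReal (ν.gap
        ((fixedHorizon τ pull hpull out hcard hout).retained (s, x))) ≤ g s x) ∧
      ∫⁻ s, ∫⁻ x, g s x ∂ν.rewardLaw ∂(uniformArm n) < ENNReal.ofReal r) :
    (fixedHorizon τ pull hpull out hcard hout).SolvesRBAR r := by
  intro ν
  set A := fixedHorizon τ pull hpull out hcard hout
  refine ⟨ae_of_all _ fun ω => by rw [stoppingTime_fixedHorizon]; exact ENat.natCast_ne_top τ, ?_⟩
  obtain ⟨g, hg, hgap, hlt⟩ := h ν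
  have hg' : Measurable fun p : Fin n × (ℕ → Fin n → ℝ) => g p.1 p.2 :=
    measurable_from_prod_countable_right hg
  have hle : ∫⁻ ω, ENNReal.ofReal (ν.gap (A.retained ω)) ∂(A.law ν) < ENNReal.ofReal r := by
    refine lt_of_le_of_lt (lintegral_mono fun ω => hgap ω.1 ω.2) ?_
    exact lt_of_eq_of_lt (lintegral_prod _ hg'.aemeasurable) hlt
  by_cases hmeas : AEStronglyMeasurable (fun ω => ν.gap (A.retained ω)) (A.law ν)
  · rw [integral_eq_lintegral_of_nonneg_ae (ae_of_all _ fun ω => ν.gap_nonneg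
      (Finset.card_pos.1 (by rw [A.card_retained]; exact hm))) hmeas]
    exact (ENNReal.toReal_lt_of_lt_ofReal hle)
  · rwa [integral_non_aestronglyMeasurable hmeas]

end FixedHorizon

end RetentionAlgorithm

/-! ### The knockout tournament -/

/-- The first round of level `l` of a knockout tournament with `2 ^ L` slots, in which each of the
`2 ^ (L - l)` slots left at level `l` is pulled `q l` times. -/
def levelStart (L : ℕ) (q : ℕ → ℕ) : ℕ → ℕ
  | 0 => 0
  | l + 1 => levelStart L q l + 2 ^ (L - l) * q l

theorem monotone_levelStart (L : ℕ) (q : ℕ → ℕ) : Monotone (levelStart L q) :=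
  monotone_nat_of_le_succ fun _ => Nat.le_add_right _ _

theorem add_lt_levelStart_succ {L : ℕ} {q : ℕ → ℕ} {l κ v : ℕ} (hκ : κ < 2 ^ (L - l))
    (hv : v < q l) : levelStart L q l + κ * q l + v < levelStart L q (l + 1) := by
  have : (κ + 1) * q l ≤ 2 ^ (L - l) * q l := Nat.mul_le_mul_right _ hκ
  rw [add_mul, one_mul] at this
  simp only [levelStart]
  omega

/-- The level to which round `t` belongs. -/
def levelAt (L : ℕ) (q : ℕ → ℕ) (t : ℕ) : ℕ :=
  Nat.findGreatest (fun l => levelStart L q l ≤ t) L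

theorem levelAt_eq {L : ℕ} {q : ℕ → ℕ} {l t : ℕ} (hl : l < L) (h : levelStart L q l ≤ t)
    (h' : t < levelStart L q (l + 1)) : levelAt L q t = l := by
  refine Nat.findGreatest_eq_iff.2 ⟨hl.le, fun _ => h, fun j hj _ => ?_⟩
  exact not_le.2 (h'.trans_le (monotone_levelStart L q hj))

section Winner

variable {n : ℕ}

/-- The total reward of slot `κ` in level `l`, for the reward sequence `y`. -/
def slotTotal (L : ℕ) (q : ℕ → ℕ) (y : ℕ → ℝ) (l κ : ℕ) : ℝ :=
  ∑ v ∈ Finset.range (q l), y (levelStart L q l + κ * q l + v)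

/-- The arm in slot `κ` at level `l`, when the slots are initially occupied by the arms `e` and
the rewards are `y`: the arms in the slots `2 κ` and `2 κ + 1` play a duel for slot `κ` of the next
level, and the one with the larger total reward wins. -/
noncomputable def slotArm (L : ℕ) (q : ℕ → ℕ) (e : ℕ → Fin n) (y : ℕ → ℝ) : ℕ → ℕ → Fin n
  | 0, κ => e κ
  | l + 1, κ =>
    if slotTotal L q y l (2 * κ + 1) ≤ slotTotal L q y l (2 * κ)
    then slotArm L q e y l (2 * κ) else slotArm L q e y l (2 * κ + 1)

variable {L : ℕ} {q : ℕ → ℕ} {e : ℕ → Fin n}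

theorem measurable_slotTotal (l κ : ℕ) : Measurable fun y => slotTotal L q y l κ :=
  Finset.measurable_sum _ fun _ _ => measurable_pi_apply _

theorem measurable_slotArm (l κ : ℕ) : Measurable fun y => slotArm L q e y l κ := by
  induction l generalizing κ with
  | zero => exact measurable_const
  | succ l ih =>
    exact Measurable.ite (measurableSet_le (measurable_slotTotal _ _) (measurable_slotTotal _ _))
      (ih _) (ih _)

theorem slotArm_mem_range (y : ℕ → ℝ) (l κ : ℕ) : slotArm L q e y l κ ∈ range e := by
  induction l generalizing κ with
  | zero => exact ⟨κ, rfl⟩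
  | succ l ih =>
    unfold slotArm
    split_ifs
    · exact ih _
    · exact ih _

theorem two_mul_add_one_lt_two_pow {l κ : ℕ} (hl : l < L) (hκ : κ < 2 ^ (L - (l + 1))) :
    2 * κ + 1 < 2 ^ (L - l) := by
  have : L - l = L - (l + 1) + 1 := by omega
  rw [this, pow_succ]
  omega

theorem slotArm_congr {y z : ℕ → ℝ} {l κ : ℕ} (hl : l ≤ L) (hκ : κ < 2 ^ (L - l))
    (h : ∀ u < levelStart L q l, y u = z u) : slotArm L q e y l κ = slotArm L q e z l κ := by
  induction l generalizing κ with
  | zero => rfl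
  | succ l ih =>
    have hκ' := two_mul_add_one_lt_two_pow hl hκ
    have ht : ∀ j < 2 ^ (L - l), slotTotal L q y l j = slotTotal L q z l j := fun j hj =>
      Finset.sum_congr rfl fun v hv => h _ (add_lt_levelStart_succ hj (Finset.mem_range.1 hv))
    have ih' : ∀ j < 2 ^ (L - l), slotArm L q e y l j = slotArm L q e z l j := fun j hj =>
      ih (by omega) hj fun u hu => h u (hu.trans_le (monotone_levelStart L q l.le_succ))
    simp only [slotArm]
    rw [ht _ hκ', ht (2 * κ) (by omega), ih' _ hκ', ih' (2 * κ) (by omega)]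

/-- The arm pulled in round `t` of the tournament. -/
noncomputable def tournamentPull (L : ℕ) (q : ℕ → ℕ) (e : ℕ → Fin n) (y : ℕ → ℝ) (t : ℕ) :
    Fin n :=
  slotArm L q e y (levelAt L q t) ((t - levelStart L q (levelAt L q t)) / q (levelAt L q t))

theorem measurable_tournamentPull (t : ℕ) :
    Measurable fun y => tournamentPull L q e y t :=
  measurable_slotArm _ _

theorem tournamentPull_eq {y : ℕ → ℝ} {l κ v : ℕ} (hl : l < L) (hκ : κ < 2 ^ (L - l))
    (hv : v < q l) : tournamentPull L q e y (levelStart L q l + κ * q l + v)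
      = slotArm L q e y l κ := by
  have hlev : levelAt L q (levelStart L q l + κ * q l + v) = l :=
    levelAt_eq hl (by omega) (add_lt_levelStart_succ hκ hv)
  have hdiv : (levelStart L q l + κ * q l + v - levelStart L q l) / q l = κ := by
    rw [add_assoc, Nat.add_sub_cancel_left, mul_comm, Nat.mul_add_div (by omega),
      Nat.div_eq_of_lt hv, add_zero]
  rw [tournamentPull, hlev, hdiv]

end Winner

namespace RetentionAlgorithm

variable {n m : ℕ} {A : RetentionAlgorithm n m} {L : ℕ} {w : ℕ → ℕ} {e : ℕ → Fin n}

/-- Whoever occupies slot `κ` of level `l`, the mean absolute error of its empirical mean is small: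
the occupant is determined by the rewards of earlier levels, of which the rewards of this level are
independent. -/
theorem lintegral_slotTotal_error_le (ν : BanditInstance n) (s : A.Seed)
    (hplay : ∀ x l κ v, l < L → κ < 2 ^ (L - l) → v < w l ^ 2 →
      A.reward (s, x) (levelStart L (fun l => w l ^ 2) l + κ * w l ^ 2 + v)
        = x (levelStart L (fun l => w l ^ 2) l + κ * w l ^ 2 + v)
          (slotArm L (fun l => w l ^ 2) e (A.reward (s, x)) l κ))
    {l κ : ℕ} (hl : l < L) (hκ : κ < 2 ^ (L - l)) (hw : 0 < w l) :
    ∫⁻ x, ENNReal.ofReal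
        |slotTotal L (fun l => w l ^ 2) (A.reward (s, x)) l κ / (w l : ℝ) ^ 2
          - ν.mean (slotArm L (fun l => w l ^ 2) e (A.reward (s, x)) l κ)| ∂ν.rewardLaw
      ≤ ENNReal.ofReal (1 / w l) := by
  set q : ℕ → ℕ := fun l => w l ^ 2 with hq
  have hrew : Measurable fun x : ℕ → Fin n → ℝ => A.reward (s, x) :=
    A.measurable_reward.comp (measurable_prodMk_left (x := s))
  have hmeas : Measurable fun x : ℕ → Fin n → ℝ => ENNReal.ofReal
      |slotTotal L q (A.reward (s, x)) l κ / (w l : ℝ) ^ 2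
        - ν.mean (slotArm L q e (A.reward (s, x)) l κ)| :=
    (continuous_abs.measurable.comp ((((measurable_slotTotal l κ).comp hrew).div_const _).sub
      ((measurable_of_countable ν.mean).comp ((measurable_slotArm l κ).comp hrew)))).ennreal_ofReal
  rw [ν.lintegral_rewardLaw_splice (levelStart L q l) hmeas]
  have hinner : ∀ x, ∫⁻ y, ENNReal.ofReal
      |slotTotal L q (A.reward (s, spliceAt (levelStart L q l) x y)) l κ / (w l : ℝ) ^ 2
        - ν.mean (slotArm L q e (A.reward (s, spliceAt (levelStart L q l) x y)) l κ)|
        ∂ν.rewardLaw ≤ ENNReal.ofReal (1 / w l) := by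
    intro x
    refine le_trans (le_of_eq (lintegral_congr fun y => ?_))
      (ν.lintegral_abs_empiricalMean_sub_mean_le (slotArm L q e (A.reward (s, x)) l κ)
        (levelStart L q l + κ * q l) hw)
    have harm : slotArm L q e (A.reward (s, spliceAt (levelStart L q l) x y)) l κ
        = slotArm L q e (A.reward (s, x)) l κ :=
      slotArm_congr hl.le hκ fun u hu =>
        A.reward_congr s (fun v hv => spliceAt_of_lt hv x y) hu
    have htot : slotTotal L q (A.reward (s, spliceAt (levelStart L q l) x y)) l κ
        = ∑ v ∈ Finset.range (w l ^ 2),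
          y (levelStart L q l + κ * q l + v) (slotArm L q e (A.reward (s, x)) l κ) := by
      refine Finset.sum_congr rfl fun v hv => ?_
      rw [hplay _ l κ v hl hκ (Finset.mem_range.1 hv), harm, spliceAt_of_le]
      omega
    rw [harm, htot]
  calc _ ≤ ∫⁻ _, ENNReal.ofReal (1 / w l) ∂ν.rewardLaw := lintegral_mono hinner
    _ = _ := by rw [lintegral_const, measure_univ, mul_one]

/-- Loss of a duel between two arms with means `a`, `b` and empirical means `a'`, `b'`. -/
theorem sub_ite_le {c a b a' b' d : ℝ} {P : Prop} [Decidable P] (hP : P ↔ b' ≤ a')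
    (hd : d = a ∨ d = b) :
    c - (if P then a else b) ≤ (c - d) + |a' - a| + |b' - b| := by
  simp only [hP]
  have h1 := abs_le.1 (le_refl |a' - a|)
  have h2 := abs_le.1 (le_refl |b' - b|)
  split_ifs with h <;> rcases hd with rfl | rfl <;> linarith [h1.1, h1.2, h2.1, h2.2]

/-- The expected loss of the arm that occupies, at level `l`, the slot reached from the starting
slot `π` of a given arm.  Only the duels on this path matter, one for each level. -/
theorem lintegral_mean_slotArm_le (ν : BanditInstance n) (s : A.Seed)
    (hplay : ∀ x l κ v, l < L → κ < 2 ^ (L - l) → v < w l ^ 2 →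
      A.reward (s, x) (levelStart L (fun l => w l ^ 2) l + κ * w l ^ 2 + v)
        = x (levelStart L (fun l => w l ^ 2) l + κ * w l ^ 2 + v)
          (slotArm L (fun l => w l ^ 2) e (A.reward (s, x)) l κ))
    (hw : ∀ l, 0 < w l) {π : ℕ} (hπ : π < 2 ^ L) {l : ℕ} (hl : l ≤ L) :
    ∫⁻ x, ENNReal.ofReal (ν.mean (e π)
        - ν.mean (slotArm L (fun l => w l ^ 2) e (A.reward (s, x)) l (π / 2 ^ l))) ∂ν.rewardLaw
      ≤ ENNReal.ofReal (∑ j ∈ Finset.range l, 2 / (w j : ℝ)) := by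
  induction l with
  | zero => simp [slotArm]
  | succ l ih =>
    have hlL : l < L := hl
    set q : ℕ → ℕ := fun l => w l ^ 2 with hq
    set κ := π / 2 ^ (l + 1) with hκ
    have hκlt : κ < 2 ^ (L - (l + 1)) := by
      rw [hκ, Nat.div_lt_iff_lt_mul (by positivity), ← pow_add, Nat.sub_add_cancel hl]
      exact hπ
    have hκ1 := two_mul_add_one_lt_two_pow hlL hκlt
    have hκ0 : 2 * κ < 2 ^ (L - l) := by omega
    have hparent : π / 2 ^ l = 2 * κ ∨ π / 2 ^ l = 2 * κ + 1 := by
      have : κ = π / 2 ^ l / 2 := by rw [hκ, pow_succ, Nat.div_div_eq_div_mul]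
      omega
    have hrew : Measurable fun x : ℕ → Fin n → ℝ => A.reward (s, x) :=
      A.measurable_reward.comp (measurable_prodMk_left (x := s))
    have hmean : ∀ j, Measurable fun x : ℕ → Fin n → ℝ =>
        ν.mean (slotArm L q e (A.reward (s, x)) l j) := fun j =>
      (measurable_of_countable ν.mean).comp ((measurable_slotArm l j).comp hrew)
    have herr : ∀ j, Measurable fun x : ℕ → Fin n → ℝ => ENNReal.ofReal
        |slotTotal L q (A.reward (s, x)) l j / (w l : ℝ) ^ 2
          - ν.mean (slotArm L q e (A.reward (s, x)) l j)| := fun j =>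
      (continuous_abs.measurable.comp
        ((((measurable_slotTotal l j).comp hrew).div_const _).sub (hmean j))).ennreal_ofReal
    have hw2 : (0 : ℝ) < (w l : ℝ) ^ 2 := pow_pos (Nat.cast_pos.2 (hw l)) 2
    have hduel : ∀ x, ENNReal.ofReal (ν.mean (e π)
          - ν.mean (slotArm L q e (A.reward (s, x)) (l + 1) κ))
        ≤ ENNReal.ofReal (ν.mean (e π)
            - ν.mean (slotArm L q e (A.reward (s, x)) l (π / 2 ^ l)))
          + ENNReal.ofReal |slotTotal L q (A.reward (s, x)) l (2 * κ) / (w l : ℝ) ^ 2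
            - ν.mean (slotArm L q e (A.reward (s, x)) l (2 * κ))|
          + ENNReal.ofReal |slotTotal L q (A.reward (s, x)) l (2 * κ + 1) / (w l : ℝ) ^ 2
            - ν.mean (slotArm L q e (A.reward (s, x)) l (2 * κ + 1))| := by
      intro x
      refine le_trans (ENNReal.ofReal_le_ofReal ?_)
        (ENNReal.ofReal_add_le.trans (add_le_add_left ENNReal.ofReal_add_le _))
      rw [slotArm, apply_ite ν.mean]
      refine sub_ite_le (div_le_div_iff_of_pos_right hw2).symm ?_
      rcases hparent with h | h <;> simp [h]
    calc _ ≤ _ := lintegral_mono hduel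
      _ = _ := lintegral_add_right _ (herr _)
      _ = _ := by rw [lintegral_add_right _ (herr _)]
      _ ≤ ENNReal.ofReal (∑ j ∈ Finset.range l, 2 / (w j : ℝ)) + ENNReal.ofReal (1 / w l)
          + ENNReal.ofReal (1 / w l) :=
        add_le_add (add_le_add (ih hlL.le)
          (lintegral_slotTotal_error_le ν s hplay hlL hκ0 (hw l)))
          (lintegral_slotTotal_error_le ν s hplay hlL hκ1 (hw l))
      _ = _ := by
        have h1 : (0 : ℝ) ≤ ∑ j ∈ Finset.range l, 2 / (w j : ℝ) :=
          Finset.sum_nonneg fun j _ => by positivity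
        have h2 : (0 : ℝ) ≤ 1 / (w l : ℝ) := by positivity
        rw [← ENNReal.ofReal_add h1 h2, ← ENNReal.ofReal_add (add_nonneg h1 h2) h2,
          Finset.sum_range_succ]
        congr 1
        ring

/-! ### Algorithms that discard arms of a random window -/

/-- Retain everything outside a random cyclic window, without sampling. -/
noncomputable def blindGuess [NeZero n] (hmn : m ≤ n) : RetentionAlgorithm n m :=
  fixedHorizon 0 (fun _ s _ => s) (fun _ _ => measurable_const)
    (fun s _ => (cyclicWindow (n - m) s)ᶜ)
    (fun s _ => by
      rw [Finset.card_compl, Fintype.card_fin, card_cyclicWindow (Nat.sub_le n m)]; omega)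
    (fun _ _ => MeasurableSet.const _)

theorem retained_blindGuess [NeZero n] (hmn : m ≤ n) (s : Fin n) (x : ℕ → Fin n → ℝ) :
    (blindGuess hmn).retained (s, x) = (cyclicWindow (n - m) s)ᶜ :=
  retained_fixedHorizon _

theorem expectedSamples_blindGuess [NeZero n] (hmn : m ≤ n) (ν : BanditInstance n) :
    (blindGuess hmn).expectedSamples ν = 0 :=
  (expectedSamples_fixedHorizon ν).trans Nat.cast_zero

/-- The initial occupant of slot `κ`: the arms of the window of `k + 1` arms that starts at `s`,
the last of which is repeated as often as necessary. -/
def windowArm [NeZero n] (k : ℕ) (s : Fin n) (κ : ℕ) : Fin n := s + Fin.ofNat n (min κ k)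

theorem windowArm_mem [NeZero n] (k : ℕ) (s : Fin n) (κ : ℕ) :
    windowArm k s κ ∈ cyclicWindow (k + 1) s := by
  rw [mem_cyclicWindow, windowArm, add_sub_cancel_left, Fin.val_ofNat]
  exact (Nat.mod_le _ _).trans_lt (Nat.lt_succ_of_le (min_le_right κ k))

theorem windowArm_val_sub [NeZero n] {k : ℕ} {s a : Fin n} (h : a ∈ cyclicWindow (k + 1) s) :
    windowArm k s (a - s).val = a := by
  rw [mem_cyclicWindow] at h
  rw [windowArm, min_eq_left (Nat.lt_succ_iff.1 h)]
  have : Fin.ofNat n (a - s).val = a - s := by simp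
  rw [this, add_sub_cancel]

/-- Play a tournament among the arms of a random cyclic window of `n - m + 1` arms, and discard
all of them but the winner. -/
noncomputable def tournament [NeZero n] (hm : 1 ≤ m) (hmn : m < n) (L : ℕ) (q : ℕ → ℕ) :
    RetentionAlgorithm n m :=
  fixedHorizon (levelStart L q L)
    (fun t s y => tournamentPull L q (windowArm (n - m) s) y t)
    (fun _ _ => measurable_tournamentPull _)
    (fun s y => ((cyclicWindow (n - m + 1) s).erase
      (slotArm L q (windowArm (n - m) s) y L 0))ᶜ)
    (fun s y => by
      obtain ⟨κ, hκ⟩ := slotArm_mem_range (L := L) (q := q) (e := windowArm (n - m) s) y L 0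
      rw [Finset.card_compl, Fintype.card_fin, Finset.card_erase_of_mem, card_cyclicWindow]
      · omega
      · omega
      · rw [← hκ]
        exact windowArm_mem _ s κ)
    (fun s i => by
      simp only [Finset.mem_compl, Finset.mem_erase, not_and_or, not_not, ofPred_or]
      exact (measurableSet_eq_fun measurable_const (measurable_slotArm _ _)).union
        (MeasurableSet.const _))

theorem reward_tournament [NeZero n] (hm : 1 ≤ m) (hmn : m < n) {q : ℕ → ℕ} (s : Fin n)
    (x : ℕ → Fin n → ℝ) {l κ v : ℕ} (hl : l < L) (hκ : κ < 2 ^ (L - l)) (hv : v < q l) :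
    (tournament hm hmn L q).reward (s, x) (levelStart L q l + κ * q l + v)
      = x (levelStart L q l + κ * q l + v) (slotArm L q (windowArm (n - m) s)
          ((tournament hm hmn L q).reward (s, x)) l κ) := by
  set A := tournament hm hmn L q
  set t := levelStart L q l + κ * q l + v
  have hpull : A.pull t s (A.history (s, x) t)
      = tournamentPull L q (windowArm (n - m) s) (rewardSeq (A.history (s, x) t)) t := rfl
  have h : A.pull t s (A.history (s, x) t)
      = slotArm L q (windowArm (n - m) s) (A.reward (s, x)) l κ := by
    rw [hpull, tournamentPull_eq hl hκ hv]
    exact slotArm_congr hl.le hκ fun u hu => A.rewardSeq_history (s, x) (by omega)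
  simp only [reward] at h ⊢
  rw [h]

theorem retained_tournament [NeZero n] (hm : 1 ≤ m) (hmn : m < n) {q : ℕ → ℕ} (s : Fin n)
    (x : ℕ → Fin n → ℝ) :
    (tournament hm hmn L q).retained (s, x) = ((cyclicWindow (n - m + 1) s).erase
      (slotArm L q (windowArm (n - m) s) ((tournament hm hmn L q).reward (s, x)) L 0))ᶜ := by
  refine (retained_fixedHorizon _).trans ?_
  congr 2
  exact slotArm_congr le_rfl (by simp) fun u hu =>
    (tournament hm hmn L q).rewardSeq_history (s, x) hu

theorem expectedSamples_tournament [NeZero n] (hm : 1 ≤ m) (hmn : m < n) {q : ℕ → ℕ}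
    (ν : BanditInstance n) :
    (tournament hm hmn L q).expectedSamples ν = levelStart L q L :=
  expectedSamples_fixedHorizon ν

end RetentionAlgorithm

/-! ### The upper bound -/

namespace RetentionAlgorithm

variable {n m : ℕ}

theorem SolvesRBAR.sampleComplexityRBAR_le {A : RetentionAlgorithm n m} {r : ℝ}
    (hA : A.SolvesRBAR r) {b : ℝ≥0∞} (hb : ∀ ν, A.expectedSamples ν ≤ b) :
    sampleComplexityRBAR n m r ≤ b :=
  (iInf₂_le A hA).trans (iSup_le hb)

/-- The best arm is discarded with probability `(n - m) / n`, and the gap is at most `1`. -/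
theorem solvesRBAR_blindGuess [NeZero n] (hm : 1 ≤ m) (hmn : m < n) {r : ℝ}
    (hr : ((n : ℝ) - m) / n < r) : (blindGuess (n := n) hmn.le).SolvesRBAR r := by
  have hn : (0 : ℝ) < n := Nat.cast_pos.2 (by omega)
  have hk : (0 : ℝ) < (n : ℝ) - m := sub_pos.2 (Nat.cast_lt.2 hmn)
  refine solvesRBAR_fixedHorizon ((div_pos hk hn).trans hr) hm fun ν => ?_
  obtain ⟨a, ha⟩ := exists_eq_ciSup_of_finite (f := ν.mean)
  have hgap : ∀ (s : Fin n) (x : ℕ → Fin n → ℝ), ENNReal.ofReal (ν.gap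
      ((blindGuess (n := n) hmn.le).retained (s, x)))
      ≤ if a ∈ cyclicWindow (n - m) s then 1 else 0 := by
    intro s x
    rw [retained_blindGuess]
    split_ifs with h
    · refine (ENNReal.ofReal_le_ofReal (ν.gap_le_one ?_)).trans ENNReal.ofReal_one.le
      rw [← Finset.card_pos, Finset.card_compl, Fintype.card_fin,
        card_cyclicWindow (Nat.sub_le n m)]
      omega
    · refine (ENNReal.ofReal_of_nonpos ?_).le
      have := ν.gap_le_of_mem (Finset.mem_compl.2 h)
      rwa [← ha, sub_self] at this
  refine ⟨fun s _ => if a ∈ cyclicWindow (n - m) s then 1 else 0, fun s => measurable_const,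
    hgap, ?_⟩
  · simp only [lintegral_const, measure_univ, mul_one]
    rw [lintegral_mem_cyclicWindow (Nat.sub_le n m), mul_one, ← ENNReal.ofReal_natCast n,
      ← ENNReal.ofReal_natCast (n - m), ← ENNReal.ofReal_inv_of_pos hn,
      ← ENNReal.ofReal_mul (by positivity), ENNReal.ofReal_lt_ofReal_iff_of_nonneg (by positivity),
      Nat.cast_sub hmn.le, inv_mul_eq_div]
    exact hr

/-- The best arm takes part in the tournament with probability `(n - m + 1) / n`.  If it does, the
expected loss is the one along its path; otherwise it is retained. -/
theorem solvesRBAR_tournament [NeZero n] (hm : 1 ≤ m) (hmn : m < n) {r : ℝ} (hr : 0 < r) {L : ℕ}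
    (hL : n - m + 1 ≤ 2 ^ L) {w : ℕ → ℕ} (hw : ∀ l, 0 < w l)
    (hsum : ((n : ℝ) - m + 1) / n * ∑ j ∈ Finset.range L, 2 / (w j : ℝ) < r) :
    (tournament hm hmn L fun l => w l ^ 2).SolvesRBAR r := by
  have hn : (0 : ℝ) < n := Nat.cast_pos.2 (by omega)
  have hk : (0 : ℝ) < (n : ℝ) - m := sub_pos.2 (Nat.cast_lt.2 hmn)
  refine solvesRBAR_fixedHorizon hr hm fun ν => ?_
  obtain ⟨a, ha⟩ := exists_eq_ciSup_of_finite (f := ν.mean)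
  set A := tournament hm hmn L fun l => w l ^ 2
  let W : Fin n → (ℕ → Fin n → ℝ) → Fin n := fun s x =>
    slotArm L (fun l => w l ^ 2) (windowArm (n - m) s) (A.reward (s, x)) L 0
  have hWmeas : ∀ s, Measurable (W s) := fun s =>
    (measurable_slotArm L 0).comp (A.measurable_reward.comp (measurable_prodMk_left (x := s)))
  have hgap : ∀ (s : Fin n) (x : ℕ → Fin n → ℝ), ENNReal.ofReal (ν.gap (A.retained (s, x)))
      ≤ if a ∈ cyclicWindow (n - m + 1) s
        then ENNReal.ofReal (ν.mean a - ν.mean (W s x)) else 0 := by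
    intro s x
    have hret : A.retained (s, x) = ((cyclicWindow (n - m + 1) s).erase (W s x))ᶜ :=
      retained_tournament hm hmn s x
    split_ifs with h
    · refine ENNReal.ofReal_le_ofReal ?_
      rw [ha]
      refine ν.gap_le_of_mem ?_
      rw [hret]
      simp
    · refine (ENNReal.ofReal_of_nonpos ?_).le
      have hmem : a ∈ A.retained (s, x) := by
        rw [hret]
        simp [h]
      have := ν.gap_le_of_mem hmem
      rwa [← ha, sub_self] at this
  have hmeas : ∀ s : Fin n, Measurable fun x => if a ∈ cyclicWindow (n - m + 1) s
      then ENNReal.ofReal (ν.mean a - ν.mean (W s x)) else 0 := by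
    intro s
    split_ifs
    · exact (measurable_const.sub
        ((measurable_of_countable ν.mean).comp (hWmeas s))).ennreal_ofReal
    · exact measurable_const
  refine ⟨fun s x => if a ∈ cyclicWindow (n - m + 1) s
    then ENNReal.ofReal (ν.mean a - ν.mean (W s x)) else 0, hmeas, hgap, ?_⟩
  · have hsum0 : (0 : ℝ) ≤ ∑ j ∈ Finset.range L, 2 / (w j : ℝ) :=
      Finset.sum_nonneg fun j _ => by positivity
    have hinner : ∀ s, ∫⁻ x, (if a ∈ cyclicWindow (n - m + 1) s
        then ENNReal.ofReal (ν.mean a - ν.mean (W s x)) else 0) ∂ν.rewardLaw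
        ≤ if a ∈ cyclicWindow (n - m + 1) s
          then ENNReal.ofReal (∑ j ∈ Finset.range L, 2 / (w j : ℝ)) else 0 := by
      intro s
      split_ifs with h
      · have hπ : (a - s).val < 2 ^ L := (mem_cyclicWindow.1 h).trans_le hL
        have := lintegral_mean_slotArm_le (A := A) (e := windowArm (n - m) s) ν s
          (fun x l κ v hl hκ hv => reward_tournament hm hmn s x hl hκ hv) hw hπ le_rfl
        rwa [windowArm_val_sub h, Nat.div_eq_of_lt hπ] at this
      · simp
    refine lt_of_le_of_lt (lintegral_mono hinner) ?_
    rw [lintegral_mem_cyclicWindow (by omega), ← ENNReal.ofReal_natCast n,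
      ← ENNReal.ofReal_natCast (n - m + 1), ← ENNReal.ofReal_inv_of_pos hn,
      ← ENNReal.ofReal_mul (by positivity), ← ENNReal.ofReal_mul (by positivity),
      ENNReal.ofReal_lt_ofReal_iff_of_nonneg (by positivity)]
    refine lt_of_eq_of_lt ?_ hsum
    rw [Nat.cast_add, Nat.cast_sub hmn.le, Nat.cast_one]
    ring

end RetentionAlgorithm

/-- The lengths of the levels of a tournament grow slowly enough for the first level to dominate. -/
theorem levelStart_le {L : ℕ} {w : ℕ → ℕ} {K : ℝ}
    (hw : ∀ l, (w l : ℝ) ≤ K * (5 / 4) ^ l) {l : ℕ} (hl : l ≤ L) :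
    (levelStart L (fun l => w l ^ 2) l : ℝ)
      ≤ 2 ^ L * K ^ 2 * (32 / 7) * (1 - (25 / 32) ^ l) := by
  induction l with
  | zero => simp [levelStart]
  | succ l ih =>
    have h1 : ((2 : ℝ) ^ (L - l)) = 2 ^ L / 2 ^ l := by
      rw [eq_div_iff (by positivity), ← pow_add, Nat.sub_add_cancel (by omega)]
    have h2 : (w l : ℝ) ^ 2 ≤ (K * (5 / 4) ^ l) ^ 2 :=
      pow_le_pow_left₀ (Nat.cast_nonneg _) (hw l) 2
    have h3 : (2 : ℝ) ^ L / 2 ^ l * (K * (5 / 4) ^ l) ^ 2 = 2 ^ L * K ^ 2 * (25 / 32) ^ l := by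
      have : (25 / 32 : ℝ) ^ l = ((5 / 4) ^ l) ^ 2 / 2 ^ l := by
        rw [← pow_mul, mul_comm l 2, pow_mul, ← div_pow]
        norm_num
      rw [this]
      ring
    have h4 := mul_le_mul_of_nonneg_left h2 (by positivity : (0 : ℝ) ≤ 2 ^ L / 2 ^ l)
    rw [h3] at h4
    simp only [levelStart]
    push_cast
    rw [h1]
    have := ih (by omega)
    rw [pow_succ (25 / 32 : ℝ) l]
    linarith

theorem sum_two_div_le {w : ℕ → ℕ} {K : ℝ} (hK : 0 < K)
    (hw : ∀ l, K * (5 / 4) ^ l ≤ (w l : ℝ)) (L : ℕ) :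
    ∑ j ∈ Finset.range L, 2 / (w j : ℝ) ≤ 10 / K * (1 - (4 / 5) ^ L) := by
  induction L with
  | zero => simp
  | succ L ih =>
    have h1 : 2 / (w L : ℝ) ≤ 2 / (K * (5 / 4) ^ L) :=
      div_le_div_of_nonneg_left zero_le_two (by positivity) (hw L)
    have h2 : 2 / (K * (5 / 4) ^ L) = 10 / K * ((4 / 5) ^ L - (4 / 5) ^ (L + 1)) := by
      have : (4 / 5 : ℝ) ^ L = 1 / (5 / 4) ^ L := by rw [← one_div_pow]; norm_num
      rw [pow_succ, this]
      field_simp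
      norm_num
    rw [Finset.sum_range_succ]
    linarith

theorem sampleComplexityRBAR_le {n m : ℕ} {r : ℝ} (hm : 1 ≤ m) (hmn : m < n) (hr : 0 < r) :
    sampleComplexityRBAR n m r
      ≤ ENNReal.ofReal (120000 * (((n : ℝ) - m) ^ 3 / (n * r) ^ 2)) := by
  have : NeZero n := ⟨by omega⟩
  have hn : (0 : ℝ) < n := Nat.cast_pos.2 (by omega)
  have hk1 : (1 : ℝ) ≤ (n : ℝ) - m := by
    have : ((m + 1 : ℕ) : ℝ) ≤ n := Nat.cast_le.2 hmn
    push_cast at this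
    linarith
  set k : ℝ := (n : ℝ) - m with hk
  rcases lt_or_ge (k / n) r with hlt | hge
  · refine (RetentionAlgorithm.solvesRBAR_blindGuess hm hmn hlt).sampleComplexityRBAR_le fun ν => ?_
    rw [RetentionAlgorithm.expectedSamples_blindGuess]
    exact zero_le
  · have hnr : n * r ≤ k := by
      rw [le_div_iff₀ hn] at hge
      linarith
    have hnr0 : 0 < n * r := mul_pos hn hr
    -- The tournament has to lose at most `n r / (2 (k + 1)) = 10 / K` if the best arm plays.
    set K : ℝ := 20 * (k + 1) / (n * r) with hKdef
    have hK1 : 1 ≤ K := by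
      rw [hKdef, le_div_iff₀ hnr0]
      linarith
    have hK0 : 0 < K := by linarith
    have hge1 : ∀ l : ℕ, (1 : ℝ) ≤ K * (5 / 4) ^ l := fun l =>
      one_le_mul_of_one_le_of_one_le hK1 (one_le_pow₀ (by norm_num))
    let w : ℕ → ℕ := fun l => ⌈K * (5 / 4) ^ l⌉₊
    have hw : ∀ l, 0 < w l := fun l => Nat.ceil_pos.2 (zero_lt_one.trans_le (hge1 l))
    have hwlow : ∀ l, K * (5 / 4) ^ l ≤ (w l : ℝ) := fun l => Nat.le_ceil _
    have hwup : ∀ l, (w l : ℝ) ≤ 2 * K * (5 / 4) ^ l := fun l => by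
      have := Nat.ceil_lt_add_one (zero_le_one.trans (hge1 l))
      have h1 := hge1 l
      simp only [w]
      linarith
    let L := Nat.clog 2 (n - m + 1)
    have hL : n - m + 1 ≤ 2 ^ L := Nat.le_pow_clog one_lt_two _
    have hL2 : (2 : ℝ) ^ L ≤ 2 * (k + 1) := by
      have h1 : 2 ^ (L - 1) < n - m + 1 := Nat.pow_pred_clog_lt_self one_lt_two (by omega)
      have hLpos : 0 < L := Nat.clog_pos one_lt_two (by omega)
      have h2 : 2 ^ L ≤ 2 * (n - m + 1) := by
        have : 2 ^ L = 2 * 2 ^ (L - 1) := by rw [← pow_succ', Nat.sub_add_cancel hLpos]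
        omega
      have h3 : ((2 ^ L : ℕ) : ℝ) ≤ ((2 * (n - m + 1) : ℕ) : ℝ) := Nat.cast_le.2 h2
      rw [Nat.cast_mul, Nat.cast_add, Nat.cast_sub hmn.le] at h3
      push_cast at h3
      exact h3
    have hsum : (k + 1) / n * ∑ j ∈ Finset.range L, 2 / (w j : ℝ) < r := by
      have h1 : ∑ j ∈ Finset.range L, 2 / (w j : ℝ) ≤ 10 / K := by
        refine (sum_two_div_le hK0 hwlow L).trans ?_
        have : (0 : ℝ) ≤ 10 / K * (4 / 5) ^ L := by positivity
        linarith
      calc (k + 1) / n * ∑ j ∈ Finset.range L, 2 / (w j : ℝ)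
          ≤ (k + 1) / n * (10 / K) := mul_le_mul_of_nonneg_left h1 (by positivity)
        _ = r / 2 := by
          rw [hKdef]
          field_simp
          norm_num
        _ < r := half_lt_self hr
    refine (RetentionAlgorithm.solvesRBAR_tournament hm hmn hr hL hw
      hsum).sampleComplexityRBAR_le fun ν => ?_
    rw [RetentionAlgorithm.expectedSamples_tournament,
      ← ENNReal.ofReal_natCast]
    refine ENNReal.ofReal_le_ofReal ((levelStart_le hwup le_rfl).trans ?_)
    have hcube : (k + 1) ^ 3 ≤ 8 * k ^ 3 := by
      calc (k + 1) ^ 3 ≤ (2 * k) ^ 3 := pow_le_pow_left₀ (by linarith) (by linarith) 3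
        _ = 8 * k ^ 3 := by ring
    calc (2 : ℝ) ^ L * (2 * K) ^ 2 * (32 / 7) * (1 - (25 / 32) ^ L)
        ≤ 2 ^ L * (2 * K) ^ 2 * (32 / 7) := by
          refine mul_le_of_le_one_right (by positivity) ?_
          have : (0 : ℝ) ≤ (25 / 32) ^ L := by positivity
          linarith
      _ ≤ 2 * (k + 1) * (2 * K) ^ 2 * (32 / 7) := by gcongr
      _ = 102400 / 7 * ((k + 1) ^ 3 / (n * r) ^ 2) := by
          rw [hKdef]
          field_simp
          norm_num
      _ ≤ 102400 / 7 * (8 * k ^ 3 / (n * r) ^ 2) := by gcongr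
      _ ≤ 120000 * (k ^ 3 / (n * r) ^ 2) := by
          have : (0 : ℝ) ≤ k ^ 3 / (n * r) ^ 2 := by positivity
          rw [mul_div_assoc]
          linarith

theorem theorem2 :
    ∃ C : ℝ, 0 < C ∧ ∀ β : ℝ, 0 < β → β < 1 → ∃ c : ℝ, 0 < c ∧
      ∀ (n m : ℕ) (r : ℝ), 1 ≤ m → m < n → 0 < r →
        sampleComplexityRBAR n m r
            ≤ ENNReal.ofReal (C * (((n : ℝ) - (m : ℝ)) ^ 3 / ((n : ℝ) * r) ^ 2)) ∧
          (r ≤ (1 - β) * (((n : ℝ) - (m : ℝ)) / (n : ℝ)) →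
            ENNReal.ofReal (c * (((n : ℝ) - (m : ℝ)) ^ 3 / ((n : ℝ) * r) ^ 2))
              ≤ sampleComplexityRBAR n m r) := by
  refine ⟨120000, by norm_num, fun β hβ0 hβ1 =>
    ⟨(-Real.log (1 - β / 2) - β / 2) * (β * (1 - β / 2) / 4) ^ 2, ?_, fun n m r hm hmn hr =>
      ⟨sampleComplexityRBAR_le hm hmn hr, le_sampleComplexityRBAR ⟨hβ0, hβ1⟩ hm hmn hr⟩⟩⟩
  have h := neg_log_one_sub_sub_pos (b := β / 2) ⟨by linarith, by linarith⟩
  have : 0 < 1 - β / 2 := by linarith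
  positivity
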